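/- Let $G$ be a totally disconnected, locally compact group, let $x\in G$, and let $U\le G$ be a compact open subgroup. Put $U_{\pm}=\bigcap_{n\ge 0}x^{\pm n}Ux^{\mp n}$ and $U_{--}=\bigcup_{n\in\mathbb Z}x^nU_-x^{-n}$, and suppose that $U$ is tidy for $x$, that is, $U=U_+U_-$ and $U_{--}$ is closed. Suppose that the scale $q:=s(x^{-1})=[x^{-1}U_-x:U_-]$ is finite and greater than $1$. Write $V=U_-$, $H=U_{--}$ and $L=H\rtimes\langle x\rangle\le G$. Let $T_{q+1}$ be the regular tree of valency $q+1$ and give its isometry group $\mathrm{Isom}(T_{q+1})$ the topology of pointwise convergence on vertices. A scale-group representation of $L$ on $T_{q+1}$ is a continuous homomorphism $L\to\mathrm{Isom}(T_{q+1})$ whose image is closed, fixes an end of $T_{q+1}$ and is transitive on the vertices. Two such representations $\rho,\rho'$ are conjugate if there is $g\in\mathrm{Isom}(T_{q+1})$ with $\rho'(y)=g\rho(y)g^{-1}$ for all $y\in L$. Let $T$ be the graph with vertex set $L/V$ in which $gV$ is joined to $gxV$ for all $g\in L$. Then $T$ is isomorphic to $T_{q+1}$, and for every graph isomorphism $T\cong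 T_{q+1}$ the homomorphism $\rho: L\to\mathrm{Isom}(T_{q+1})$ obtained from the action of $L$ on $L/V$ by left multiplication is a scale-group representation. It is unique up to conjugacy, meaning that every scale-group representation of $L$ on $T_{q+1}$ is conjugate to $\rho$, if and only if the action of $V$ by left multiplication on the coset space $V/xVx^{-1}$ is primitive. -/

import Mathlib

open scoped Pointwise

/-! ## Ends and isometries of a tree, scale groups -/

namespace ScaleGroup

section Tree

variable {X : Type*} {T : SimpleGraph X}

/-- A ray: a one-sided infinite path without repeated vertices. -/
structure Ray (T : SimpleGraph X) where
  /-- the sequence of vertices of the ray -/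
  vert : ℕ → X
  adj : ∀ n, T.Adj (vert n) (vert (n + 1))
  inj : Function.Injective vert

/-- Two rays are equivalent if they have a common tail. -/
def Ray.Cofinal (r s : Ray T) : Prop :=
  ∃ m n : ℕ, ∀ k : ℕ, r.vert (m + k) = s.vert (n + k)

theorem Ray.cofinal_equivalence : Equivalence (Ray.Cofinal (T := T)) where
  refl r := ⟨0, 0, fun _ => rfl⟩
  symm := by
    rintro r s ⟨m, n, h⟩
    exact ⟨n, m, fun k => (h k).symm⟩
  trans := by
    rintro r s t ⟨m, n, h⟩ ⟨m', n', h'⟩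
    refine ⟨m + m', n' + n, fun k => ?_⟩
    rw [add_assoc, h, add_assoc, ← h']
    congr 1
    omega

/-- The equivalence relation on rays whose classes are the ends. -/
def Ray.setoid (T : SimpleGraph X) : Setoid (Ray T) :=
  ⟨Ray.Cofinal, Ray.cofinal_equivalence⟩

/-- The ends of a tree (the boundary `∂T`): classes of rays modulo common tails. -/
def TreeEnd (T : SimpleGraph X) : Type _ := Quotient (Ray.setoid T)

/-- The image of a ray under an automorphism. -/
def Ray.map (g : T ≃g T) (r : Ray T) : Ray T where
  vert n := g (r.vert n)
  adj n := g.map_rel_iff.2 (r.adj n)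
  inj := g.injective.comp r.inj

/-- The action of automorphisms of the tree on its ends. -/
def TreeEnd.map (g : T ≃g T) : TreeEnd T → TreeEnd T :=
  Quotient.map' (Ray.map g) (by
    rintro r s ⟨m, n, h⟩
    exact ⟨m, n, fun k => congrArg g (h k)⟩)

/-- The topology of pointwise convergence (for the discrete topology on the vertices) on the
group `T ≃g T` of isometries of `T`. -/
instance isomTopology (T : SimpleGraph X) : TopologicalSpace (T ≃g T) :=
  TopologicalSpace.induced (fun g : T ≃g T => (g : X → X))
    (@Pi.topologicalSpace X (fun _ => X) (fun _ => ⊥))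

/-- A scale group on `T`: a closed group of isometries that fixes an end and is transitive on
the vertices. -/
def IsScaleGroup (P : Subgroup (T ≃g T)) : Prop :=
  IsClosed (P : Set (T ≃g T)) ∧
  (∃ ω : TreeEnd T, ∀ g ∈ P, TreeEnd.map g ω = ω) ∧
  ∀ u v : X, ∃ g ∈ P, g u = v

/-- A scale-group representation of a topological group `L` on `T`: a continuous homomorphism to
the isometry group of `T` whose image is a scale group. -/
def IsScaleRep {L : Type*} [Group L] [TopologicalSpace L] (ρ : L →* (T ≃g T)) : Prop :=
  Continuous ρ ∧ IsScaleGroup ρ.range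

/-- Two homomorphisms to the isometry group of `T` are conjugate. -/
def AreConjugate {L : Type*} [Group L] (ρ₁ ρ₂ : L →* (T ≃g T)) : Prop :=
  ∃ g : T ≃g T, ∀ y : L, ρ₂ y = g * ρ₁ y * g⁻¹

end Tree

/-! ## Tidy subgroups and the scale -/

section Tidy

variable {G : Type*} [Group G]

/-- The conjugate `g U g⁻¹`. -/
def conj (g : G) (U : Subgroup G) : Subgroup G := U.map (MulAut.conj g).toMonoidHom

/-- `U₊ = ⋂_{n ≥ 0} xⁿ U x⁻ⁿ`. -/
def plusPart (x : G) (U : Subgroup G) : Subgroup G := ⨅ n : ℕ, conj (x ^ n) U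

/-- `U₋ = ⋂_{n ≥ 0} x⁻ⁿ U xⁿ`. -/
def minusPart (x : G) (U : Subgroup G) : Subgroup G := plusPart x⁻¹ U

/-- `U₋₋ = ⋃_{n ∈ ℤ} xⁿ U₋ x⁻ⁿ`. The union is that of a chain, see `coe_minusMinus`, so that
the supremum of subgroups is the union of sets. -/
def minusMinus (x : G) (U : Subgroup G) : Subgroup G :=
  ⨆ n : ℤ, conj (x ^ n) (minusPart x U)

theorem mem_conj {g h : G} {U : Subgroup G} : h ∈ conj g U ↔ g⁻¹ * h * g ∈ U := by
  constructor
  · rintro ⟨u, hu, rfl⟩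
    have : g⁻¹ * (g * u * g⁻¹) * g = u := by group
    simpa [this] using hu
  · intro hh
    refine ⟨_, hh, ?_⟩
    simp [mul_assoc]

theorem conj_mul (g h : G) (U : Subgroup G) : conj (g * h) U = conj g (conj h U) := by
  ext y
  simp [mem_conj, mul_assoc]

theorem conj_mono (g : G) {U W : Subgroup G} (h : U ≤ W) : conj g U ≤ conj g W :=
  Subgroup.map_mono h

theorem conj_minusPart_le (x : G) (U : Subgroup G) :
    conj x (minusPart x U) ≤ minusPart x U := by
  intro y hy
  rw [mem_conj] at hy
  simp only [minusPart, plusPart, Subgroup.mem_iInf, mem_conj] at hy ⊢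
  intro n
  have := hy (n + 1)
  simpa [pow_succ', mul_assoc] using this

theorem conj_pow_minusPart_le (x : G) (U : Subgroup G) (n : ℕ) :
    conj (x ^ n) (minusPart x U) ≤ minusPart x U := by
  induction n with
  | zero => intro y hy; simpa [mem_conj] using hy
  | succ n ih =>
    rw [pow_succ, conj_mul]
    exact (conj_mono _ (conj_minusPart_le x U)).trans ih

theorem coe_minusMinus (x : G) (U : Subgroup G) :
    (minusMinus x U : Set G) = ⋃ n : ℤ, (conj (x ^ n) (minusPart x U) : Set G) := by
  have anti : ∀ m n : ℤ, m ≤ n →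
      conj (x ^ n) (minusPart x U) ≤ conj (x ^ m) (minusPart x U) := by
    intro m n h
    obtain ⟨k, rfl⟩ := Int.le.dest h
    rw [zpow_add, conj_mul, zpow_natCast]
    exact conj_mono _ (conj_pow_minusPart_le x U k)
  refine Subgroup.coe_iSup_of_directed fun m n => ⟨min m n, ?_, ?_⟩
  · exact anti _ _ (min_le_left m n)
  · exact anti _ _ (min_le_right m n)

/-- A compact open subgroup `U` of a topological group is tidy for `x` if `U = U₊U₋` and `U₋₋`
is closed. -/
structure IsTidy [TopologicalSpace G] (x : G) (U : Subgroup G) : Prop where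
  isCompact : IsCompact (U : Set G)
  isOpen : IsOpen (U : Set G)
  factor : (U : Set G) = (plusPart x U : Set G) * (minusPart x U : Set G)
  isClosed : IsClosed (minusMinus x U : Set G)

/-- The index `[x U₊ x⁻¹ : U₊]`. When `U` is tidy for `x` this is the scale `s(x)`, which does
not depend on `U`. Since a subgroup is tidy for `x⁻¹` when it is tidy for `x`, `scaleAt x⁻¹ U` is
`s(x⁻¹)` when `U` is tidy for `x`. (An infinite index would count as `0`.) -/
noncomputable def scaleAt (x : G) (U : Subgroup G) : ℕ :=
  (plusPart x U).relIndex (conj x (plusPart x U))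

/-- The group `U₋₋ ⋊ ⟨x⟩`, as the subgroup of `G` generated by `U₋₋` and `x`, with the topology
of `G`. -/
def semidirect (x : G) (U : Subgroup G) : Subgroup G :=
  minusMinus x U ⊔ Subgroup.zpowers x

/-- `U₋` as a subgroup of `U₋₋ ⋊ ⟨x⟩`. -/
def baseSubgroup (x : G) (U : Subgroup G) : Subgroup (semidirect x U) :=
  (minusPart x U).subgroupOf (semidirect x U)

/-- `x` as an element of `U₋₋ ⋊ ⟨x⟩`. -/
def generator (x : G) (U : Subgroup G) : semidirect x U :=
  ⟨x, Subgroup.mem_sup_right (Subgroup.mem_zpowers x)⟩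

/-! ## The tree representation -/

/-- The tree of the tree representation theorem (the Bass–Serre tree of the ascending
HNN-extension `U₋₋ ⋊ ⟨x⟩` of `U₋`). With `V = U₋` and `L = U₋₋ ⋊ ⟨x⟩`, the vertices are the cosets
in `L / V`, and `gV` is joined to `gxV` for every `g` in `L`. The usual description has the cosets
`h (xⁿVx⁻ⁿ)` with `h ∈ U₋₋`, `n ∈ ℤ` as vertices, and edges from `h (xⁿVx⁻ⁿ)` to
`h (xⁿ⁺¹Vx⁻ⁿ⁻¹)`; the coset `h (xⁿVx⁻ⁿ)` of level `n` corresponds to `h xⁿ V` here, and the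
action of `L` is left multiplication. -/
def cosetTree (x : G) (U : Subgroup G) : SimpleGraph (semidirect x U ⧸ baseSubgroup x U) :=
  SimpleGraph.fromRel fun a b =>
    ∃ g : semidirect x U, a = QuotientGroup.mk g ∧ b = QuotientGroup.mk (g * generator x U)

/-- `ρ` is the representation of `U₋₋ ⋊ ⟨x⟩` on `T` given by the tree representation theorem: the
action on `cosetTree x U` by left multiplication, carried to `T` by a graph isomorphism. -/
def IsTreeRepresentation (x : G) (U : Subgroup G) {X : Type*} {T : SimpleGraph X}
    (ρ : semidirect x U →* (T ≃g T)) : Prop :=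
  ∃ φ : cosetTree x U ≃g T,
    ∀ (y : semidirect x U) (a : semidirect x U ⧸ baseSubgroup x U), φ (y • a) = ρ y (φ a)

end Tidy

end ScaleGroup

/-! Conjugation by `x` maps `V` into itself with index `q`, and every element of `L` is `x⁻ⁿ v xᵐ`
with `v ∈ V` (`IsContracting`). Hence `gV ↦ gx⁻¹V` has fibres of size `q`, and any two cosets merge
under its iterates: it is a parent map pointing to an end fixed by `L`. An end of a regular tree
also gives a parent map (`Ray.exists_isParentMap`), and two trees with parent maps of the same `q`
are isomorphic (`IsParentMap.exists_iso`), so the coset tree is `T`. The action is a scale-group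
representation because `V` is compact and open in `L` (`IsCosetRep.isScaleRep`).

Primitivity says that `xVx⁻¹` is maximal in `V`. A group `D` between the two is contracting with the
same `q`, so `L / D` gives another scale-group representation. If it is conjugate to `ρ`, then `D`
is a conjugate of `V`, and an index count (`IsContracting.eq_of_eq_conj`) leaves only the two
extremes.

Conversely, in any scale-group representation the vertices on a level are permuted by the compact
group `V`, and `x` translates by one step away from the fixed end. On the axis of `x` there is a
last vertex `w` fixed by `V`. Maximality forces the stabiliser of `xw` in `V` to be `xVx⁻¹`;
iterating, the stabiliser of `w` in `L` is `V`, and `gV ↦ gw` identifies the coset tree with `T`.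

Openness of `V` in `L` is the topological input: Baire gives it in `U₋₋`, and `U ∩ L ⊆ U₋₋` because
no compact set contains all positive powers of a positive power of `x`. -/

namespace ScaleGroup

/-! ### Parent maps and the trees they determine. -/

section ParentMap

variable {X Y : Type*} {T : SimpleGraph X} {T' : SimpleGraph Y} {q : ℕ} {p : X → X} {p' : Y → Y}

/-- `p` moves every vertex of `T` one step towards a fixed end, and every vertex is the parent of
exactly `q` vertices. -/
structure IsParentMap (T : SimpleGraph X) (q : ℕ) (p : X → X) : Prop where
  adj_iff : ∀ a b, T.Adj a b ↔ p a = b ∨ p b = a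
  common : ∀ a b, ∃ m n, p^[m] a = p^[n] b
  aperiodic : ∀ a n, p^[n + 1] a ≠ a
  card_children : ∀ a, Nat.card {b // p b = a} = q

theorem IsParentMap.iterate_injective (hp : IsParentMap T q p) (a : X) :
    Function.Injective fun n => p^[n] a := by
  have key : ∀ m k, p^[m + k + 1] a ≠ p^[m] a := fun m k h => by
    refine hp.aperiodic (p^[m] a) k ?_
    rw [← Function.iterate_add_apply, ← h]
    congr 1; omega
  intro m n h
  rcases lt_trichotomy m n with hlt | rfl | hlt
  · obtain ⟨k, rfl⟩ := Nat.exists_eq_add_of_lt hlt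
    exact (key m k h.symm).elim
  · rfl
  · obtain ⟨k, rfl⟩ := Nat.exists_eq_add_of_lt hlt
    exact (key n k h).elim

/-- A level function (Busemann function) of the end. -/
theorem IsParentMap.exists_level (hp : IsParentMap T q p) (o : X) :
    ∃ l : X → ℤ, ∀ a, l (p a) = l a - 1 := by
  choose m n h using fun a => hp.common a o
  have wd : ∀ a i j, p^[i] a = p^[j] o → (m a : ℤ) - n a = i - j := fun a i j hij => by
    have : p^[i + n a] o = p^[m a + j] o := by
      rw [Function.iterate_add_apply, ← h, ← Function.iterate_add_apply, Nat.add_comm,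
        Function.iterate_add_apply, hij, ← Function.iterate_add_apply]
    have := hp.iterate_injective o this
    omega
  refine ⟨fun a => m a - n a, fun a => ?_⟩
  have := wd a (m (p a) + 1) (n (p a)) (by rw [Function.iterate_succ_apply, h])
  push_cast at this
  linarith

theorem level_iterate {l : X → ℤ} (hl : ∀ a, l (p a) = l a - 1) (n : ℕ) (a : X) :
    l (p^[n] a) = l a - n := by
  induction n generalizing a with
  | zero => simp
  | succ n ih => rw [Function.iterate_succ_apply, ih, hl]; push_cast; ring

theorem IsParentMap.exists_iterate_eq (hp : IsParentMap T q p) {l : X → ℤ}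
    (hl : ∀ a, l (p a) = l a - 1) {a b : X} (hab : l a = l b) : ∃ n, p^[n] a = p^[n] b := by
  obtain ⟨m, n, h⟩ := hp.common a b
  have := congrArg l h
  rw [level_iterate hl, level_iterate hl] at this
  obtain rfl : m = n := by omega
  exact ⟨m, h⟩

/-- Coordinates on `X`: the level of a vertex, and the labels of its ancestors. -/
theorem IsParentMap.exists_coordinates (hp : IsParentMap T q p) (o : X) (z : Fin q) :
    ∃ (l : X → ℤ) (c : X → Fin q), (∀ a, l (p a) = l a - 1) ∧
      Function.Injective (fun a => (l a, fun k : ℕ => c (p^[k] a))) ∧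
      Set.range (fun a => (l a, fun k : ℕ => c (p^[k] a))) =
        {s : ℤ × (ℕ → Fin q) | ∃ N, ∀ k, N ≤ k → s.2 k = z} := by
  have hq : q ≠ 0 := fun h => by subst h; exact z.elim0
  obtain ⟨l, hl⟩ := hp.exists_level o
  -- Label the children of each vertex so that `o` and all its ancestors get `z`. Since every vertex
  -- shares an ancestor with `o`, every sequence of ancestor labels is then eventually `z`.
  have labels : ∀ a, ∃ e : {b // p b = a} ≃ Fin q,
      ∀ n (h : p (p^[n] o) = a), e ⟨p^[n] o, h⟩ = z := fun a => by
    have : Finite {b // p b = a} := Nat.finite_of_card_ne_zero (by rw [hp.card_children]; exact hq)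
    obtain ⟨e⟩ : Nonempty ({b // p b = a} ≃ Fin q) :=
      ⟨Finite.equivFinOfCardEq (hp.card_children a)⟩
    by_cases hn : ∃ n, p (p^[n] o) = a
    · obtain ⟨n, hn⟩ := hn
      refine ⟨e.trans (Equiv.swap (e ⟨_, hn⟩) z), fun m hm => ?_⟩
      have : p^[m + 1] o = p^[n + 1] o := by
        rw [Function.iterate_succ_apply', Function.iterate_succ_apply', hm, hn]
      obtain rfl : m = n := Nat.succ_injective (hp.iterate_injective o this)
      simp
    · exact ⟨e, fun n h => (hn ⟨n, h⟩).elim⟩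
  choose e he using labels
  let c : X → Fin q := fun a => e (p a) ⟨a, rfl⟩
  have hc : ∀ u i, ∃ v, p v = u ∧ c v = i := fun u i => by
    obtain ⟨⟨v, rfl⟩, hv⟩ := (e u).surjective i
    exact ⟨v, rfl, hv⟩
  have hinj : ∀ a b, p a = p b → c a = c b → a = b := fun a b h1 h2 => by
    have : ∀ u (h : p a = u), c a = e u ⟨a, h⟩ := by rintro u rfl; rfl
    rw [this _ h1] at h2
    exact congrArg Subtype.val ((e (p b)).injective h2)
  have hco : ∀ n, c (p^[n] o) = z := fun n => he _ n rfl
  refine ⟨l, c, hl, fun a b hab => ?_, Set.Subset.antisymm ?_ ?_⟩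
  · simp only [Prod.mk.injEq] at hab
    obtain ⟨n, hn⟩ := hp.exists_iterate_eq hl hab.1
    induction n with
    | zero => exact hn
    | succ n ih =>
      refine ih (hinj _ _ ?_ (congrFun hab.2 n))
      simpa only [Function.iterate_succ_apply'] using hn
  · rintro _ ⟨a, rfl⟩
    obtain ⟨m, n, h⟩ := hp.common a o
    refine ⟨m, fun k hk => ?_⟩
    obtain ⟨j, rfl⟩ := Nat.exists_eq_add_of_le' hk
    simp only
    rw [Function.iterate_add_apply, h, ← Function.iterate_add_apply]
    exact hco _
  -- Descend `n` generations from `u`, choosing the children with labels `s (n - 1), …, s 0`.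
  · have step : ∀ (n : ℕ) (i : ℤ) (s : ℕ → Fin q),
        (∃ u, l u = i - n ∧ ∀ k, c (p^[k] u) = s (k + n)) → ∃ u, l u = i ∧ ∀ k, c (p^[k] u) = s k := by
      intro n
      induction n with
      | zero => rintro i s ⟨u, h1, h2⟩; exact ⟨u, by simpa using h1, h2⟩
      | succ n ih =>
        rintro i s ⟨u, h1, h2⟩
        obtain ⟨v, rfl, hv⟩ := hc u (s n)
        rw [hl] at h1
        refine ih i s ⟨v, by push_cast at h1; linarith, fun k => ?_⟩
        cases k with
        | zero => simpa using hv
        | succ k => rw [Function.iterate_succ_apply, h2]; congr 1; omega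
    rintro ⟨i, s⟩ ⟨N, hN⟩
    -- Start at an ancestor of `o`. Going up `N` levels reaches the constant tail of `s`; the extra
    -- `(i - l o)⁺` makes the starting level at most `l o`, so that such an ancestor exists.
    obtain ⟨u, h1, h2⟩ := step (N + (i - l o).toNat) i s
      ⟨p^[(l o - (i - (N + (i - l o).toNat : ℕ))).toNat] o, by
        rw [level_iterate hl]; push_cast; omega, fun k => by
        rw [← Function.iterate_add_apply, hco]; exact (hN _ (by omega)).symm⟩
    exact ⟨u, Prod.ext h1 (funext h2)⟩

/-- The set of coordinates depends only on `q`, and in coordinates the parent map lowers the level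
by one and shifts the labels. Matching coordinates therefore commutes with the parent maps, which
determine adjacency. -/
theorem IsParentMap.exists_iso (hp : IsParentMap T q p) (hp' : IsParentMap T' q p')
    (hq : 0 < q) [Nonempty X] [Nonempty Y] : ∃ φ : T ≃g T', ∀ a, φ (p a) = p' (φ a) := by
  obtain ⟨l, c, hl, hinj, hran⟩ := hp.exists_coordinates (Classical.arbitrary X) ⟨0, hq⟩
  obtain ⟨l', c', hl', hinj', hran'⟩ := hp'.exists_coordinates (Classical.arbitrary Y) ⟨0, hq⟩
  let f : X ≃ Y := (Equiv.ofInjective _ hinj).trans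
    ((Equiv.setCongr (hran.trans hran'.symm)).trans (Equiv.ofInjective _ hinj').symm)
  have hf : ∀ a, (l' (f a), fun k : ℕ => c' (p'^[k] (f a))) = (l a, fun k : ℕ => c (p^[k] a)) := by
    intro a
    exact congrArg Subtype.val (Equiv.apply_symm_apply (Equiv.ofInjective _ hinj') _)
  have hfp : ∀ a, f (p a) = p' (f a) := fun a => by
    apply hinj'
    refine (hf (p a)).trans ?_
    have h := hf a
    simp only [Prod.mk.injEq] at h
    simp only [Prod.mk.injEq, hl, hl', h.1, true_and, ← Function.iterate_succ_apply]
    exact funext fun k => (congrFun h.2 (k + 1)).symm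
  refine ⟨⟨f, fun {a b} => ?_⟩, hfp⟩
  rw [hp.adj_iff, hp'.adj_iff, ← hfp, ← hfp, f.apply_eq_iff_eq, f.apply_eq_iff_eq]

end ParentMap

/-! ### Rays and ends of a tree. -/

section Rays

variable {X : Type*} {T : SimpleGraph X}

theorem injective_of_nonbacktracking (hT : T.IsAcyclic) {f : ℕ → X}
    (hadj : ∀ n, T.Adj (f n) (f (n + 1))) (hne : ∀ n, f (n + 2) ≠ f n) :
    Function.Injective f := by
  have path : ∀ m n, ∃ w : T.Walk (f (m + n + 1)) (f m), w.IsPath ∧ w.snd = f (m + n) := by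
    intro m n
    induction n with
    | zero =>
      exact ⟨.cons (hadj m).symm .nil, by simp [(hadj m).ne'], rfl⟩
    | succ n ih =>
      obtain ⟨w, hw, hs⟩ := ih
      refine ⟨.cons (hadj (m + n + 1)).symm w, (SimpleGraph.Walk.cons_isPath_iff _ _).2 ⟨hw, ?_⟩, by simp; rfl⟩
      -- In an acyclic graph, a neighbour of the start of a path that lies on the path is its second
      -- vertex, so a repetition here would be a backtrack.
      intro hmem
      have := hT.eq_snd_of_adj_start hw (hadj (m + n + 1)) hmem
      exact hne (m + n) (this.trans hs)
  have key : ∀ m n, f (m + n + 1) ≠ f m := by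
    intro m n h
    obtain ⟨w, hw, hs⟩ := path m n
    have : ∀ v (w : T.Walk (f (m + n + 1)) v), w.IsPath → v = f (m + n + 1) → w.snd = v := by
      rintro v w hw rfl
      rw [SimpleGraph.Walk.isPath_iff_nil, ← SimpleGraph.Walk.eq_nil_iff_nil] at hw
      subst hw; rfl
    have := this _ w hw h.symm
    rw [hs, ← h] at this
    exact (hadj (m + n)).ne this
  intro m n h
  rcases lt_trichotomy m n with hlt | rfl | hlt
  · obtain ⟨k, rfl⟩ := Nat.exists_eq_add_of_lt hlt
    exact (key m k h.symm).elim
  · rfl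
  · obtain ⟨k, rfl⟩ := Nat.exists_eq_add_of_lt hlt
    exact (key n k h).elim

theorem Ray.vert_add_two_ne (r : Ray T) (n : ℕ) : r.vert (n + 2) ≠ r.vert n := fun h => by
  have := r.inj h
  omega

/-- The ray without its first vertex. -/
def Ray.tail (r : Ray T) : Ray T where
  vert n := r.vert (n + 1)
  adj n := r.adj (n + 1)
  inj := r.inj.comp (Nat.succ_injective)

theorem Ray.tail_cofinal (r : Ray T) : r.tail.Cofinal r :=
  ⟨0, 1, fun k => by simp [Ray.tail, Nat.add_comm]⟩

theorem Ray.exists_cons (hT : T.IsAcyclic) (r : Ray T) {v : X} (hv : T.Adj v (r.vert 0))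
    (hne : r.vert 1 ≠ v) : ∃ s : Ray T, s.vert 0 = v ∧ ∀ n, s.vert (n + 1) = r.vert n := by
  let f : ℕ → X := fun n => n.casesOn v r.vert
  have hadj : ∀ n, T.Adj (f n) (f (n + 1)) := by
    rintro (_ | n)
    · exact hv
    · exact r.adj n
  refine ⟨⟨f, hadj, injective_of_nonbacktracking hT hadj ?_⟩, rfl, fun _ => rfl⟩
  rintro (_ | n)
  · exact hne
  · exact r.vert_add_two_ne n

theorem Ray.exists_cofinal_of_adj (hT : T.IsAcyclic) (r : Ray T) {v : X}
    (hv : T.Adj v (r.vert 0)) : ∃ s : Ray T, s.vert 0 = v ∧ s.Cofinal r := by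
  by_cases hne : r.vert 1 = v
  · exact ⟨r.tail, hne, r.tail_cofinal⟩
  · obtain ⟨s, h0, hs⟩ := r.exists_cons hT hv hne
    exact ⟨s, h0, 1, 0, fun k => by rw [Nat.add_comm, hs, Nat.zero_add]⟩

theorem Ray.exists_cofinal (hT : T.IsTree) (r : Ray T) (v : X) :
    ∃ s : Ray T, s.vert 0 = v ∧ s.Cofinal r := by
  obtain ⟨w⟩ := hT.connected v (r.vert 0)
  generalize hu : r.vert 0 = u at w
  induction w with
  | nil => exact ⟨r, hu, Ray.cofinal_equivalence.refl r⟩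
  | cons h _ ih =>
    obtain ⟨s, rfl, hs⟩ := ih hu
    obtain ⟨t, ht, hts⟩ := s.exists_cofinal_of_adj hT.isAcyclic h
    exact ⟨t, ht, Ray.cofinal_equivalence.trans hts hs⟩

/-- If the rays separated at once, running back along `s` and then out along `t` would be a walk
without backtracking, hence injective, although the common tail is visited twice. -/
theorem Ray.Cofinal.vert_one_eq (hT : T.IsAcyclic) {s t : Ray T} (hst : s.Cofinal t)
    (h0 : s.vert 0 = t.vert 0) : s.vert 1 = t.vert 1 := by
  by_contra hne
  obtain ⟨m, n, h⟩ := hst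
  -- Starting at index `m + 1` rather than `m` keeps the first edge of `s` in the walk even if `m =
  -- 0`.
  let f : ℕ → X := fun j => if j ≤ m + 1 then s.vert (m + 1 - j) else t.vert (j - (m + 1))
  have hf₁ : ∀ i j, i + j = m + 1 → f i = s.vert j := fun i j hij => by
    simp only [f]; rw [if_pos (by omega)]; congr 1; omega
  have hf₂ : ∀ j, f (m + 1 + j) = t.vert j := fun j => by
    rcases j with _ | j
    · rw [hf₁ _ 0 (by omega), h0]
    · simp only [f]; rw [if_neg (by omega)]; congr 1; omega
  have hinj : Function.Injective f := by
    refine injective_of_nonbacktracking hT (fun j => ?_) fun j => ?_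
    · rcases Nat.lt_or_ge j (m + 1) with hj | hj
      · obtain ⟨k, hk⟩ := Nat.exists_eq_add_of_lt hj
        rw [hf₁ j (k + 1) (by omega), hf₁ (j + 1) k (by omega)]
        exact (s.adj k).symm
      · obtain ⟨k, rfl⟩ := Nat.exists_eq_add_of_le hj
        rw [hf₂, Nat.add_assoc, hf₂]
        exact t.adj k
    · rcases Nat.lt_or_ge (j + 1) (m + 1) with hj | hj
      · obtain ⟨k, hk⟩ := Nat.exists_eq_add_of_lt hj
        rw [hf₁ j (k + 2) (by omega), hf₁ (j + 2) k (by omega)]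
        exact (s.vert_add_two_ne k).symm
      rcases hj.eq_or_lt with hj | hj
      · rw [hf₁ j 1 (by omega), show j + 2 = m + 1 + 1 by omega, hf₂]
        exact Ne.symm hne
      · obtain ⟨k, rfl⟩ := Nat.exists_eq_add_of_le (Nat.lt_succ_iff.1 hj)
        rw [hf₂, Nat.add_assoc, hf₂]
        exact t.vert_add_two_ne k
  have : f 0 = f (m + 1 + (n + 1)) := by
    rw [hf₁ 0 (m + 1) (by omega), hf₂, h]
  have := hinj this
  omega

theorem exists_ray (hT : T.IsTree) (hdeg : ∀ u v, T.Adj u v → ∃ w, T.Adj v w ∧ w ≠ u)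
    {u v : X} (huv : T.Adj u v) : Nonempty (Ray T) := by
  let S := {a : X × X // T.Adj a.1 a.2}
  choose g hg using fun a : S => hdeg a.1.1 a.1.2 a.2
  let step : S → S := fun a => ⟨(a.1.2, g a), (hg a).1⟩
  let f : ℕ → S := fun n => step^[n] ⟨(u, v), huv⟩
  have hf : ∀ n, f (n + 1) = step (f n) := fun n => Function.iterate_succ_apply' _ _ _
  have hadj : ∀ n, T.Adj (f n).1.1 (f (n + 1)).1.1 := fun n => by rw [hf]; exact (f n).2
  refine ⟨⟨fun n => (f n).1.1, hadj, injective_of_nonbacktracking hT.isAcyclic hadj fun n => ?_⟩⟩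
  rw [hf, hf]
  exact (hg (f n)).2

/-- An end of a regular tree defines a parent map. -/
theorem Ray.exists_isParentMap {q : ℕ} [T.LocallyFinite] (hT : T.IsTree)
    (hreg : T.IsRegularOfDegree (q + 1)) (r : Ray T) :
    ∃ p : X → X, IsParentMap T q p ∧
      ∀ g : T ≃g T, (r.map g).Cofinal r → ∀ v, p (g v) = g (p v) := by
  choose s hs0 hs using r.exists_cofinal hT
  let p : X → X := fun v => (s v).vert 1
  have hp0 : ∀ t : Ray T, t.Cofinal r → p (t.vert 0) = t.vert 1 := fun t ht =>
    Ray.Cofinal.vert_one_eq hT.isAcyclic (Ray.cofinal_equivalence.trans (hs _) (Ray.cofinal_equivalence.symm ht)) (hs0 _)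
  have hp : ∀ n, ∀ t : Ray T, t.Cofinal r → p^[n] (t.vert 0) = t.vert n := by
    intro n
    induction n with
    | zero => intro t _; rfl
    | succ n ih =>
      intro t ht
      rw [Function.iterate_succ_apply, hp0 t ht]
      exact ih t.tail (Ray.cofinal_equivalence.trans t.tail_cofinal ht)
  have hpn : ∀ n v, p^[n] v = (s v).vert n := fun n v => by
    rw [← hp n (s v) (hs v), hs0]
  have hadj : ∀ v, T.Adj v (p v) := fun v => by
    have := (s v).adj 0
    rwa [hs0] at this
  have haper : ∀ a n, p^[n + 1] a ≠ a := fun a n h => by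
    rw [hpn] at h
    have := (s a).inj (h.trans (hs0 a).symm)
    omega
  have hadj_iff : ∀ a b, T.Adj a b ↔ p a = b ∨ p b = a := fun a b => by
    refine ⟨fun h => ?_, ?_⟩
    · by_contra! hne
      -- If `b` is not the parent of `a`, then `b` followed by the ray from `a` is a ray to the same
      -- end, so `a` is the parent of `b`.
      obtain ⟨t, ht0, ht⟩ := (s a).exists_cons hT.isAcyclic (v := b) (by rw [hs0]; exact h.symm) hne.1
      have htr : t.Cofinal r := Ray.cofinal_equivalence.trans
        ⟨1, 0, fun k => by rw [Nat.add_comm, ht, Nat.zero_add]⟩ (hs a)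
      refine hne.2 ?_
      rw [← ht0, hp0 t htr, ht, hs0]
    · rintro (rfl | rfl)
      · exact hadj a
      · exact (hadj b).symm
  refine ⟨p, ⟨hadj_iff, fun a b => ?_, haper, fun a => ?_⟩, fun g hg v => ?_⟩
  · obtain ⟨m, n, h⟩ := Ray.cofinal_equivalence.trans (hs a) (Ray.cofinal_equivalence.symm (hs b))
    exact ⟨m, n, by rw [hpn, hpn]; exact h 0⟩
  -- Of the `q + 1` neighbours one is the parent, and aperiodicity keeps it from being a child.
  · have hset : T.neighborSet a = insert (p a) {b | p b = a} := by
      ext b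
      simp only [SimpleGraph.mem_neighborSet, hadj_iff, Set.mem_insert_iff, Set.mem_ofPred_eq,
        eq_comm]
    have hcard : (T.neighborSet a).ncard = q + 1 := by
      rw [← hreg a, ← SimpleGraph.card_neighborSet_eq_degree, Set.ncard_eq_toFinset_card',
        Set.toFinset_card]
    have hfin : (T.neighborSet a).Finite := Set.toFinite _
    rw [hset, Set.ncard_insert_of_notMem (show p a ∉ {b | p b = a} from haper a 1)
      (hfin.subset (by rw [hset]; exact Set.subset_insert _ _))] at hcard
    exact Nat.succ_injective hcard
  · have h1 : ((s v).map g).Cofinal r := by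
      obtain ⟨m, n, h⟩ := hs v
      have : ((s v).map g).Cofinal (r.map g) := ⟨m, n, fun k => congrArg g (h k)⟩
      exact Ray.cofinal_equivalence.trans this hg
    have := hp0 _ h1
    simp only [Ray.map, hs0] at this
    exact this

end Rays

end ScaleGroup

namespace ScaleGroup

/-! ### The topology of pointwise convergence. -/

section IsomTopology

variable {X : Type*} {T : SimpleGraph X} {Y : Type*} [TopologicalSpace Y]

theorem continuous_isom_iff {f : Y → (T ≃g T)} :
    Continuous f ↔ ∀ v w, IsOpen {y | f y v = w} := by
  let _ : TopologicalSpace X := ⊥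
  have : DiscreteTopology X := ⟨rfl⟩
  rw [continuous_induced_rng, continuous_pi_iff]
  refine forall_congr' fun v => ?_
  rw [continuous_discrete_rng]
  rfl

theorem isOpen_setOf_apply_eq (v w : X) : IsOpen {g : T ≃g T | g v = w} :=
  continuous_isom_iff.1 (continuous_id (X := T ≃g T)) v w

instance isomT2Space : T2Space (T ≃g T) := by
  let _ : TopologicalSpace X := ⊥
  have : DiscreteTopology X := ⟨rfl⟩
  exact T2Space.of_injective_continuous (f := fun g : T ≃g T => (g : X → X))
    DFunLike.coe_injective continuous_induced_dom

theorem finite_orbit_of_isCompact {f : Y → (T ≃g T)} (hf : Continuous f) {K : Set Y}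
    (hK : IsCompact K) (v : X) : ((fun y => f y v) '' K).Finite := by
  let _ : TopologicalSpace X := ⊥
  have : DiscreteTopology X := ⟨rfl⟩
  have : Continuous fun y => f y v :=
    continuous_discrete_rng.2 fun w => continuous_isom_iff.1 hf v w
  exact (hK.image this).finite_of_discrete

end IsomTopology

/-! ### Contracting pairs `(V, x)` and their coset trees. -/

section Contracting

variable {L : Type*} [Group L] {V : Subgroup L} {x : L} {q : ℕ}

theorem relIndex_conj (g : L) (A B : Subgroup L) :
    (conj g A).relIndex (conj g B) = A.relIndex B :=
  Subgroup.relIndex_map_map_of_injective _ _ (MulAut.conj g).injective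

theorem conj_one (V : Subgroup L) : conj 1 V = V := by
  ext; simp [mem_conj]

theorem conj_pow_le (h : conj x V ≤ V) (n : ℕ) : conj (x ^ n) V ≤ V := by
  induction n with
  | zero => rw [pow_zero, conj_one]
  | succ n ih =>
    rw [pow_succ, conj_mul]
    exact (conj_mono _ h).trans ih

theorem relIndex_conj_pow (h : conj x V ≤ V) (n : ℕ) :
    (conj (x ^ n) V).relIndex V = (conj x V).relIndex V ^ n := by
  induction n with
  | zero => simp [conj_one]
  | succ n ih =>
    have hle : conj (x ^ (n + 1)) V ≤ conj (x ^ n) V := by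
      rw [pow_succ, conj_mul]; exact conj_mono _ h
    rw [← Subgroup.relIndex_mul_relIndex _ _ _ hle (conj_pow_le h n), ih, pow_succ x, conj_mul,
      relIndex_conj, pow_succ, mul_comm]

/-- Conjugation by `x` maps `V` onto a subgroup of index `q`, and every element of `L` has the
form `x⁻ⁿ v xᵐ` with `v` in `V`: the group `L` is the ascending HNN-extension of `V`. -/
structure IsContracting (V : Subgroup L) (x : L) (q : ℕ) : Prop where
  conj_le : conj x V ≤ V
  exists_mem : ∀ g : L, ∃ n m : ℕ, x ^ n * g * (x ^ m)⁻¹ ∈ V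
  relIndex : (conj x V).relIndex V = q

theorem IsContracting.conj_mem (h : IsContracting V x q) {v : L} (hv : v ∈ V) :
    x * v * x⁻¹ ∈ V :=
  h.conj_le (mem_conj.2 (by simpa [mul_assoc] using hv))

theorem IsContracting.conj_pow_le (h : IsContracting V x q) (n : ℕ) : conj (x ^ n) V ≤ V :=
  ScaleGroup.conj_pow_le h.conj_le n

theorem IsContracting.relIndex_conj_pow (h : IsContracting V x q) (n : ℕ) :
    (conj (x ^ n) V).relIndex V = q ^ n := by
  rw [ScaleGroup.relIndex_conj_pow h.conj_le, h.relIndex]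

theorem IsContracting.exists_mem_of_le (h : IsContracting V x q) (g : L) (N : ℕ) :
    ∃ n m : ℕ, N ≤ n ∧ N ≤ m ∧ x ^ n * g * (x ^ m)⁻¹ ∈ V := by
  obtain ⟨n, m, hnm⟩ := h.exists_mem g
  refine ⟨N + n, N + m, by omega, by omega, ?_⟩
  refine h.conj_pow_le N (mem_conj.2 ?_)
  convert hnm using 1
  rw [pow_add, pow_add]; group

theorem IsContracting.pow_succ_notMem (h : IsContracting V x q) (hq : 1 < q) (n : ℕ) :
    x ^ (n + 1) ∉ V := by
  intro hx
  have h1 := h.relIndex_conj_pow (n + 1)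
  have : conj (x ^ (n + 1)) V = V := by
    ext y
    rw [mem_conj, Subgroup.mul_mem_cancel_right _ hx, Subgroup.mul_mem_cancel_left _ (inv_mem hx)]
  rw [this, Subgroup.relIndex_self] at h1
  exact (Nat.one_lt_pow (by omega) hq).ne h1

/-- The graph on `L / V` in which `gV` is joined to `gxV`. -/
def cosetGraph (V : Subgroup L) (x : L) : SimpleGraph (L ⧸ V) :=
  SimpleGraph.fromRel fun a b => ∃ g : L, a = QuotientGroup.mk g ∧ b = QuotientGroup.mk (g * x)

/-- The map `gV ↦ gx⁻¹V` on `L / V`. -/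
def IsContracting.parent (h : IsContracting V x q) : L ⧸ V → L ⧸ V :=
  Quotient.map' (· * x⁻¹) fun a b hab => by
    rw [QuotientGroup.leftRel_apply] at hab ⊢
    have := h.conj_mem hab
    simpa [mul_assoc] using this

theorem IsContracting.parent_mk (h : IsContracting V x q) (g : L) :
    h.parent (g : L ⧸ V) = ((g * x⁻¹ : L) : L ⧸ V) := rfl

theorem IsContracting.parent_smul (h : IsContracting V x q) (y : L) (a : L ⧸ V) :
    h.parent (y • a) = y • h.parent a := by
  obtain ⟨g, rfl⟩ := QuotientGroup.mk_surjective a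
  simp only [MulAction.Quotient.smul_mk, h.parent_mk, smul_eq_mul, mul_assoc]

theorem IsContracting.iterate_parent_smul (h : IsContracting V x q) (n : ℕ) (y : L) (a : L ⧸ V) :
    h.parent^[n] (y • a) = y • h.parent^[n] a :=
  (Function.Commute.iterate_left (f := h.parent) (g := fun b => y • b)
    (fun b => h.parent_smul y b) n) a

theorem IsContracting.iterate_parent_mk (h : IsContracting V x q) (n : ℕ) (g : L) :
    h.parent^[n] (g : L ⧸ V) = ((g * (x ^ n)⁻¹ : L) : L ⧸ V) := by
  induction n generalizing g with
  | zero => simp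
  | succ n ih =>
    rw [Function.iterate_succ_apply, h.parent_mk, ih, pow_succ, mul_inv_rev, mul_assoc]

/-- The children of `gV` are the cosets `gvxV` with `v ∈ V`, and `gvxV = gwxV` exactly when `v⁻¹w ∈
xVx⁻¹`. -/
theorem IsContracting.card_children (h : IsContracting V x q) (a : L ⧸ V) :
    Nat.card {b // h.parent b = a} = q := by
  obtain ⟨g, rfl⟩ := QuotientGroup.mk_surjective a
  refine Eq.trans ?_ h.relIndex
  rw [Subgroup.relIndex, Subgroup.index]
  have hmem : ∀ v w : V, v⁻¹ * w ∈ (conj x V).subgroupOf V ↔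
      (g * v * x)⁻¹ * (g * w * x) ∈ V := fun v w => by
    rw [Subgroup.mem_subgroupOf, mem_conj]
    simp [mul_assoc]
  refine (Nat.card_congr (Equiv.ofBijective (Quotient.lift (s := QuotientGroup.leftRel _)
    (fun v : V => (⟨((g * v * x : L) : L ⧸ V), ?_⟩ : {b // h.parent b = (g : L ⧸ V)})) ?_)
    ⟨?_, ?_⟩)).symm
  · rw [h.parent_mk, QuotientGroup.eq]
    simp
  · intro v w hvw
    rw [← Quotient.eq_iff_equiv, Quotient.eq, QuotientGroup.leftRel_apply, hmem] at hvw
    exact Subtype.ext (QuotientGroup.eq.2 hvw)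
  · rintro ⟨v⟩ ⟨w⟩ hvw
    have := QuotientGroup.eq.1 (congrArg Subtype.val hvw)
    rw [← hmem] at this
    exact QuotientGroup.eq.2 this
  · rintro ⟨b, hb⟩
    obtain ⟨k, rfl⟩ := QuotientGroup.mk_surjective b
    rw [h.parent_mk, eq_comm, QuotientGroup.eq] at hb
    refine ⟨QuotientGroup.mk ⟨_, hb⟩, Subtype.ext ?_⟩
    change ((g * (g⁻¹ * (k * x⁻¹)) * x : L) : L ⧸ V) = k
    congr 1
    group

theorem IsContracting.isParentMap (h : IsContracting V x q) (hq : 1 < q) :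
    IsParentMap (cosetGraph V x) q h.parent := by
  have aper : ∀ (a : L ⧸ V) n, h.parent^[n + 1] a ≠ a := fun a n ha => by
    obtain ⟨g, rfl⟩ := QuotientGroup.mk_surjective a
    rw [h.iterate_parent_mk, QuotientGroup.eq] at ha
    exact h.pow_succ_notMem hq n (by simpa using ha)
  have rel : ∀ a b : L ⧸ V,
      (∃ g : L, a = QuotientGroup.mk g ∧ b = QuotientGroup.mk (g * x)) ↔ h.parent b = a := by
    intro a b
    constructor
    · rintro ⟨g, rfl, rfl⟩
      rw [h.parent_mk, mul_inv_cancel_right]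
    · rintro rfl
      obtain ⟨g, rfl⟩ := QuotientGroup.mk_surjective b
      exact ⟨g * x⁻¹, rfl, by rw [inv_mul_cancel_right]⟩
  refine ⟨fun a b => ?_, fun a b => ?_, aper, h.card_children⟩
  · rw [cosetGraph, SimpleGraph.fromRel_adj, rel, rel, or_comm, and_iff_right_iff_imp]
    rintro (hab | hab) rfl <;> exact aper a 0 hab
  · obtain ⟨g, rfl⟩ := QuotientGroup.mk_surjective a
    obtain ⟨k, rfl⟩ := QuotientGroup.mk_surjective b
    obtain ⟨n, m, hnm⟩ := h.exists_mem (g⁻¹ * k)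
    refine ⟨n, m, ?_⟩
    rw [h.iterate_parent_mk, h.iterate_parent_mk, QuotientGroup.eq]
    simpa [mul_assoc] using hnm

variable {X : Type*} {T : SimpleGraph X}

/-- `ρ` is the action by left multiplication on the graph `cosetGraph V x`, carried to `T` by a
graph isomorphism. -/
def IsCosetRep (V : Subgroup L) (x : L) (ρ : L →* (T ≃g T)) : Prop :=
  ∃ φ : cosetGraph V x ≃g T, ∀ (y : L) (a : L ⧸ V), φ (y • a) = ρ y (φ a)

theorem cosetGraph_adj_smul (y : L) {a b : L ⧸ V} (hab : (cosetGraph V x).Adj a b) :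
    (cosetGraph V x).Adj (y • a) (y • b) := by
  have rel : ∀ a b : L ⧸ V,
      (∃ g : L, a = QuotientGroup.mk g ∧ b = QuotientGroup.mk (g * x)) →
      ∃ g : L, y • a = QuotientGroup.mk g ∧ y • b = QuotientGroup.mk (g * x) := by
    rintro _ _ ⟨g, rfl, rfl⟩
    exact ⟨y * g, rfl, by rw [mul_assoc]; rfl⟩
  rw [cosetGraph, SimpleGraph.fromRel_adj] at hab ⊢
  exact ⟨fun h => hab.1 (smul_left_cancel y h), hab.2.imp (rel _ _) (rel _ _)⟩

theorem exists_isCosetRep (φ : cosetGraph V x ≃g T) :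
    ∃ ρ : L →* (T ≃g T), IsCosetRep V x ρ := by
  let s : L → (cosetGraph V x ≃g cosetGraph V x) := fun y =>
    ⟨MulAction.toPerm y, fun {a b} => ⟨fun h => by
      have := cosetGraph_adj_smul y⁻¹ h
      simpa using this, cosetGraph_adj_smul y⟩⟩
  have hs : ∀ y a, s y a = y • a := fun _ _ => rfl
  let ρ : L →* (T ≃g T) :=
    { toFun := fun y => (φ.symm.trans (s y)).trans φ
      map_one' := by
        ext v
        simp [hs]
      map_mul' := fun y z => by
        ext v
        simp [hs, mul_smul] }
  refine ⟨ρ, φ, fun y a => ?_⟩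
  change _ = φ (s y (φ.symm (φ a)))
  rw [φ.symm_apply_apply, hs]

theorem IsCosetRep.areConjugate {ρ ρ' : L →* (T ≃g T)} (h : IsCosetRep V x ρ)
    (h' : IsCosetRep V x ρ') : AreConjugate ρ ρ' := by
  obtain ⟨φ, hφ⟩ := h
  obtain ⟨φ', hφ'⟩ := h'
  refine ⟨φ.symm.trans φ', fun y => ?_⟩
  rw [eq_mul_inv_iff_mul_eq]
  ext v
  obtain ⟨a, rfl⟩ := φ.surjective v
  change ρ' y (φ' (φ.symm (φ a))) = φ' (φ.symm (ρ y (φ a)))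
  rw [← hφ, φ.symm_apply_apply, φ.symm_apply_apply, hφ']

theorem IsCosetRep.exists_stabilizer {ρ : L →* (T ≃g T)} (h : IsCosetRep V x ρ) :
    ∃ v : X, ∀ y, ρ y v = v ↔ y ∈ V := by
  obtain ⟨φ, hφ⟩ := h
  refine ⟨φ ((1 : L) : L ⧸ V), fun y => ?_⟩
  rw [← hφ, φ.apply_eq_iff_eq, MulAction.Quotient.smul_mk, eq_comm, QuotientGroup.eq]
  simp

theorem IsCosetRep.exists_conj_stabilizer {ρ : L →* (T ≃g T)} (h : IsCosetRep V x ρ) (v : X) :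
    ∃ g : L, ∀ y, ρ y v = v ↔ y ∈ conj g V := by
  obtain ⟨φ, hφ⟩ := h
  obtain ⟨a, rfl⟩ := φ.surjective v
  obtain ⟨g, rfl⟩ := QuotientGroup.mk_surjective a
  refine ⟨g, fun y => ?_⟩
  rw [← hφ, φ.apply_eq_iff_eq, MulAction.Quotient.smul_mk, eq_comm, QuotientGroup.eq, mem_conj,
    smul_eq_mul, mul_assoc]

theorem IsCosetRep.isScaleRep [TopologicalSpace L] [IsTopologicalGroup L]
    (hV : IsContracting V x q) (hq : 1 < q) (ho : IsOpen (V : Set L)) (hc : IsCompact (V : Set L))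
    {ρ : L →* (T ≃g T)} (h : IsCosetRep V x ρ) : IsScaleRep ρ := by
  obtain ⟨φ, hφ⟩ := h
  have htrans : ∀ u v, ∃ y, ρ y u = v := fun u v => by
    obtain ⟨a, rfl⟩ := φ.surjective u
    obtain ⟨b, rfl⟩ := φ.surjective v
    obtain ⟨y, rfl⟩ := MulAction.exists_smul_eq L a b
    exact ⟨y, (hφ y a).symm⟩
  have hcoset : ∀ v, ∃ g : L, {y | ρ y (φ ((1 : L) : L ⧸ V)) = v} = g • (V : Set L) := fun v => by
    obtain ⟨a, rfl⟩ := φ.surjective v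
    obtain ⟨g, rfl⟩ := QuotientGroup.mk_surjective a
    refine ⟨g, Set.ext fun y => ?_⟩
    rw [Set.mem_ofPred_eq, ← hφ, φ.apply_eq_iff_eq, MulAction.Quotient.smul_mk, eq_comm,
      QuotientGroup.eq, Set.mem_smul_set_iff_inv_smul_mem]
    simp
  have hcont : Continuous ρ := continuous_isom_iff.2 fun v w => by
    obtain ⟨k, rfl⟩ := htrans (φ ((1 : L) : L ⧸ V)) v
    obtain ⟨g, hg⟩ := hcoset w
    have : {y | ρ y (ρ k (φ ((1 : L) : L ⧸ V))) = w} = (· * k) ⁻¹' (g • (V : Set L)) := by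
      rw [← hg]; ext y; simp [map_mul]
    rw [this]
    exact (ho.smul g).preimage (continuous_mul_const k)
  refine ⟨hcont, isClosed_of_closure_subset fun g hg => ?_, ?_, ?_⟩
  -- The elements of the image that agree with `g` at the base vertex form the image of one coset of
  -- `V`, which is compact and hence closed. As agreement there is an open condition, `g` lies in
  -- that image.
  · have hN := isOpen_setOf_apply_eq (T := T) (φ ((1 : L) : L ⧸ V)) (g (φ ((1 : L) : L ⧸ V)))
    obtain ⟨k, hk⟩ := hcoset (g (φ ((1 : L) : L ⧸ V)))
    have hK : IsCompact (ρ '' {y | ρ y (φ ((1 : L) : L ⧸ V)) = g (φ ((1 : L) : L ⧸ V))}) := by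
      rw [hk]; exact (hc.smul k).image hcont
    have h1 := hN.inter_closure ⟨rfl, hg⟩
    have h2 := closure_minimal (t := ρ '' {y | ρ y (φ ((1 : L) : L ⧸ V)) = g (φ ((1 : L) : L ⧸ V))})
      (by rintro _ ⟨hy, ⟨y, rfl⟩⟩; exact ⟨y, hy, rfl⟩) hK.isClosed h1
    obtain ⟨y, -, rfl⟩ := h2
    exact ⟨y, rfl⟩
  · have hp := hV.isParentMap hq
    let o : L ⧸ V := ((1 : L) : L ⧸ V)
    -- The fixed end is that of the iterated parents of the base vertex; a translate of this ray
    -- merges with it.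
    let r : Ray T :=
      ⟨fun n => φ (hV.parent^[n] o), fun n => by
        rw [φ.map_adj_iff, hp.adj_iff, Function.iterate_succ_apply']
        exact Or.inl rfl, φ.injective.comp (hp.iterate_injective o)⟩
    refine ⟨Quotient.mk (Ray.setoid T) r, ?_⟩
    rintro _ ⟨y, rfl⟩
    obtain ⟨m, n, hmn⟩ := hp.common (y • o) o
    refine Quotient.sound (s := Ray.setoid T) ⟨m, n, fun k => ?_⟩
    change ρ y (φ (hV.parent^[m + k] o)) = φ (hV.parent^[n + k] o)
    rw [← hφ, ← hV.iterate_parent_smul, Nat.add_comm, Function.iterate_add_apply, hmn,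
      ← Function.iterate_add_apply, Nat.add_comm]
  · intro u v
    obtain ⟨y, hy⟩ := htrans u v
    exact ⟨ρ y, ⟨y, rfl⟩, hy⟩

/-- This is the source of further representations. In the chain `xDx⁻¹ ≤ xVx⁻¹ ≤ D ≤ V` the index
`[xVx⁻¹ : xDx⁻¹]` equals `[V : D]`, so `[D : xDx⁻¹] = [D : xVx⁻¹][V : D] = q`. -/
theorem IsContracting.of_le (hV : IsContracting V x q) {D : Subgroup L}
    (h1 : conj x V ≤ D) (h2 : D ≤ V) : IsContracting D x q := by
  refine ⟨(conj_mono x h2).trans h1, fun g => ?_, ?_⟩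
  · obtain ⟨n, m, h⟩ := hV.exists_mem g
    -- One more conjugation by `x` moves the element from `V` into `xVx⁻¹ ≤ D`.
    refine ⟨n + 1, m + 1, h1 (mem_conj.2 ?_)⟩
    convert h using 1
    rw [pow_succ', pow_succ']; group
  · rw [← Subgroup.relIndex_mul_relIndex _ _ _ (conj_mono x h2) h1, relIndex_conj, mul_comm,
      Subgroup.relIndex_mul_relIndex _ _ _ h1 h2, hV.relIndex]

/-- Write `g = x⁻ⁿ v xᵐ` with `v ∈ V`. The index of `xⁿ(gVg⁻¹)x⁻ⁿ` in `V` is `qᵐ`, because `v`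
normalises `V`, and also `[V : gVg⁻¹] qⁿ`. So `[V : gVg⁻¹]` is a power of `q` dividing `q`, that is,
`1` or `q`. -/
theorem IsContracting.eq_of_eq_conj (hV : IsContracting V x q) (hq : 1 < q) {g : L}
    (h1 : conj x V ≤ conj g V) (h2 : conj g V ≤ V) : conj g V = conj x V ∨ conj g V = V := by
  obtain ⟨n, m, h⟩ := hV.exists_mem g
  set v := x ^ n * g * (x ^ m)⁻¹ with hv
  have hg : conj (x ^ n) (conj g V) = conj v (conj (x ^ m) V) := by
    rw [← conj_mul, ← conj_mul, hv, inv_mul_cancel_right]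
  have hvV : conj v V = V := by
    ext y
    rw [mem_conj, Subgroup.mul_mem_cancel_right _ h, Subgroup.mul_mem_cancel_left _ (inv_mem h)]
  have e1 : (conj (x ^ n) (conj g V)).relIndex V = q ^ m := by
    rw [hg]
    nth_rw 2 [← hvV]
    rw [relIndex_conj, hV.relIndex_conj_pow]
  have e2 : (conj (x ^ n) (conj g V)).relIndex V = (conj g V).relIndex V * q ^ n := by
    rw [← Subgroup.relIndex_mul_relIndex _ _ _ (conj_mono _ h2) (hV.conj_pow_le n), relIndex_conj,
      hV.relIndex_conj_pow]
  have e3 : (conj x V).relIndex (conj g V) * (conj g V).relIndex V = q := by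
    rw [Subgroup.relIndex_mul_relIndex _ _ _ h1 h2, hV.relIndex]
  rw [e1] at e2
  have hq0 : 0 < q := by omega
  have hnm : n ≤ m := by
    by_contra! hlt
    have : (conj g V).relIndex V ≠ 0 := fun h0 => by rw [h0, mul_zero] at e3; omega
    exact absurd e2 (((Nat.pow_lt_pow_right hq hlt).trans_le
      (Nat.le_mul_of_pos_left _ (Nat.pos_of_ne_zero this))).ne)
  obtain ⟨k, rfl⟩ := Nat.exists_eq_add_of_le hnm
  rw [pow_add, mul_comm] at e2
  have e4 : q ^ k = (conj g V).relIndex V := Nat.eq_of_mul_eq_mul_right (pow_pos hq0 n) e2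
  rcases k with _ | k
  · right
    rw [pow_zero, eq_comm, Subgroup.relIndex_eq_one] at e4
    exact le_antisymm h2 e4
  · left
    rw [← e4, pow_succ, ← mul_assoc] at e3
    have := Nat.eq_of_mul_eq_mul_right hq0 (e3.trans (one_mul q).symm)
    exact le_antisymm (Subgroup.relIndex_eq_one.1 (Nat.eq_one_of_dvd_one ⟨_, this.symm⟩)) h1

end Contracting

end ScaleGroup

namespace ScaleGroup

/-! ### Translations of levels and fixed vertices of compact subgroups. -/

section Level

variable {L : Type*} [Group L] {V : Subgroup L} {x : L} {q : ℕ}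
variable {X : Type*} {T : SimpleGraph X} {p : X → X} {ρ : L →* (T ≃g T)}

theorem iterate_comm (hcomm : ∀ y v, p (ρ y v) = ρ y (p v)) (n : ℕ) (y : L) (v : X) :
    p^[n] (ρ y v) = ρ y (p^[n] v) :=
  (Function.Commute.iterate_left (f := p) (g := fun b => ρ y b) (fun b => hcomm y b) n) v

/-- A group fixing the end acts on levels by translations. -/
theorem IsParentMap.exists_translation (hp : IsParentMap T q p)
    (hcomm : ∀ y v, p (ρ y v) = ρ y (p v)) {l : X → ℤ} (hl : ∀ a, l (p a) = l a - 1) (o : X) :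
    ∃ c : L → ℤ, (∀ y v, l (ρ y v) = l v + c y) ∧ (∀ y z, c (y * z) = c y + c z) := by
  have h1 : ∀ y v, l (ρ y v) = l v + (l (ρ y o) - l o) := fun y v => by
    obtain ⟨m, n, h⟩ := hp.common v o
    have h2 := congrArg (fun w => l (ρ y w)) h
    have h3 := congrArg l h
    simp only [← iterate_comm hcomm, level_iterate hl] at h2 h3
    linarith
  refine ⟨fun y => l (ρ y o) - l o, h1, fun y z => ?_⟩
  simp only [map_mul]
  have := h1 y (ρ z o)
  change l (ρ y (ρ z o)) - l o = _
  linarith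

theorem translation_pow {c : L → ℤ} (hc : ∀ y z, c (y * z) = c y + c z) (y : L) (n : ℕ) :
    c (y ^ n) = n * c y := by
  induction n with
  | zero =>
    have := hc 1 1
    rw [mul_one] at this
    simp; linarith
  | succ n ih => rw [pow_succ, hc, ih]; push_cast; ring

theorem translation_inv {c : L → ℤ} (hc : ∀ y z, c (y * z) = c y + c z) (y : L) :
    c y⁻¹ = -c y := by
  have h1 := hc y y⁻¹
  have h2 := translation_pow hc 1 0
  rw [mul_inv_cancel] at h1
  simp at h2
  linarith

theorem translation_zpow {c : L → ℤ} (hc : ∀ y z, c (y * z) = c y + c z) (y : L) (n : ℤ) :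
    c (y ^ n) = n * c y := by
  obtain ⟨k, rfl | rfl⟩ := n.eq_nat_or_neg
  · rw [zpow_natCast, translation_pow hc]
  · rw [zpow_neg, zpow_natCast, translation_inv hc, translation_pow hc]; ring

/-- A compact group has finite vertex orbits, so its image under the translation homomorphism is a
finite subgroup of `ℤ`. -/
theorem translation_eq_zero [TopologicalSpace L] (hρ : Continuous ρ)
    (hV : IsCompact (V : Set L)) {l : X → ℤ} {c : L → ℤ} (hlc : ∀ y v, l (ρ y v) = l v + c y)
    (hc : ∀ y z, c (y * z) = c y + c z) (o : X) {v : L} (hv : v ∈ V) : c v = 0 := by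
  by_contra hne
  have hfin : (c '' V).Finite := by
    refine ((finite_orbit_of_isCompact hρ hV o).image fun w => l w - l o).subset ?_
    rintro _ ⟨y, hy, rfl⟩
    exact ⟨_, Set.mem_image_of_mem _ hy, by simp [hlc]⟩
  refine Set.infinite_of_injective_forall_mem (f := fun n : ℕ => c (v ^ n)) (fun m n hmn => ?_)
    (fun n => Set.mem_image_of_mem c (pow_mem hv n)) hfin
  simpa [translation_pow hc, hne] using hmn

/-- The orbit of `o` under `V` is finite and lies on one level, so all its points have a common
ancestor. From there on, the ray from `o` to the end is fixed by `V`. -/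
theorem exists_forall_fixed [TopologicalSpace L] (hp : IsParentMap T q p) (hρ : Continuous ρ)
    (hcomm : ∀ y v, p (ρ y v) = ρ y (p v))
    (hV : IsCompact (V : Set L)) {l : X → ℤ} (hl : ∀ a, l (p a) = l a - 1)
    (hlV : ∀ y ∈ V, ∀ v, l (ρ y v) = l v) (o : X) :
    ∃ M, ∀ m, M ≤ m → ∀ y ∈ V, ρ y (p^[m] o) = p^[m] o := by
  have hfin := finite_orbit_of_isCompact hρ hV o
  have : ∀ w ∈ (fun y => ρ y o) '' (V : Set L), ∃ n, p^[n] w = p^[n] o := by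
    rintro _ ⟨y, hy, rfl⟩
    exact hp.exists_iterate_eq hl (hlV y hy o)
  choose! N hN using this
  obtain ⟨M, hM⟩ := (hfin.image N).bddAbove
  refine ⟨M, fun m hm y hy => ?_⟩
  have hy' : ρ y o ∈ (fun y => ρ y o) '' (V : Set L) := ⟨y, hy, rfl⟩
  have hle : N (ρ y o) ≤ m := (hM ⟨_, hy', rfl⟩).trans hm
  obtain ⟨k, rfl⟩ := Nat.exists_eq_add_of_le' hle
  rw [← iterate_comm hcomm, Function.iterate_add_apply, hN _ hy', ← Function.iterate_add_apply]

/-- The powers of a translation by one step are not transitive on a regular tree. -/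
theorem IsParentMap.not_transitive_zpow (hp : IsParentMap T q p) (hq : 1 < q) {l : X → ℤ}
    (hl : ∀ a, l (p a) = l a - 1) {c : L → ℤ} (hlc : ∀ y v, l (ρ y v) = l v + c y)
    (hc : ∀ y z, c (y * z) = c y + c z) (hx : c x ≠ 0) (v : X) :
    ¬ ∀ w, ∃ k : ℤ, w = ρ (x ^ k) v := by
  intro h
  have hcard := hp.card_children v
  have : Finite {b // p b = v} := Nat.finite_of_card_ne_zero (by omega)
  rw [← hcard, Finite.one_lt_card_iff_nontrivial] at hq
  -- Two children of `v` lie on one level, whereas the orbit of `v` under `⟨x⟩` meets each level at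
  -- most once.
  obtain ⟨⟨a, ha⟩, ⟨b, hb⟩, hab⟩ := hq
  refine hab (Subtype.ext ?_)
  have hlab : l a = l b := by
    have h1 := hl a
    have h2 := hl b
    rw [ha] at h1
    rw [hb] at h2
    linarith
  obtain ⟨i, rfl⟩ := h a
  obtain ⟨j, rfl⟩ := h b
  rw [hlc, hlc, translation_zpow hc, translation_zpow hc] at hlab
  have : i = j := by
    have : i * c x = j * c x := by linarith
    exact mul_right_cancel₀ hx this
  subst this
  rfl

end Level

/-! ### Uniqueness up to conjugacy and maximality of `xVx⁻¹` in `V`. -/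

section Primitive

variable {L : Type*} [Group L] {V : Subgroup L} {x : L} {q : ℕ}
variable {X : Type*} {T : SimpleGraph X} [T.LocallyFinite]

/-- If `xVx⁻¹` is maximal in `V` then every scale-group representation is the action on the
coset tree. -/
theorem IsContracting.isCosetRep_of_isScaleRep [TopologicalSpace L] (hV : IsContracting V x q) (hq : 1 < q)
    (hc : IsCompact (V : Set L))
    (hmax : ∀ D : Subgroup L, conj x V ≤ D → D ≤ V → D = conj x V ∨ D = V)
    (hT : T.IsTree) (hreg : T.IsRegularOfDegree (q + 1)) {ρ : L →* (T ≃g T)}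
    (hρ : IsScaleRep ρ) : IsCosetRep V x ρ := by
  obtain ⟨hcont, -, ⟨ω, hω⟩, htrans⟩ := hρ
  have htrans : ∀ u v, ∃ y, ρ y u = v := fun u v => by
    obtain ⟨_, ⟨y, rfl⟩, hy⟩ := htrans u v
    exact ⟨y, hy⟩
  obtain ⟨r, rfl⟩ := Quotient.exists_rep ω
  obtain ⟨p, hp, hpe⟩ := r.exists_isParentMap hT hreg
  have hcomm : ∀ y v, p (ρ y v) = ρ y (p v) := fun y v =>
    hpe (ρ y) (Quotient.exact (s := Ray.setoid T) (hω _ ⟨y, rfl⟩)) v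
  have o : X := r.vert 0
  obtain ⟨l, hl⟩ := hp.exists_level o
  obtain ⟨c, hlc, hcm⟩ := hp.exists_translation hcomm hl o
  have hcV : ∀ v ∈ V, c v = 0 := fun v hv => translation_eq_zero hcont hc hlc hcm o hv
  have hlV : ∀ y ∈ V, ∀ v, l (ρ y v) = l v := fun y hy v => by rw [hlc, hcV y hy, add_zero]
  have hcg : ∀ (g : L) (n m : ℕ), x ^ n * g * (x ^ m)⁻¹ ∈ V → c g = (m - n) * c x :=
    fun g n m h => by
      have := hcV _ h
      rw [hcm, hcm, translation_inv hcm, translation_pow hcm, translation_pow hcm] at this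
      linarith
  have hmul : ∀ y z v, ρ (y * z) v = ρ y (ρ z v) := fun y z v => by rw [map_mul]; rfl
  have hinv : ∀ y v, ρ y⁻¹ (ρ y v) = v := fun y v => by rw [← hmul]; simp
  -- Every translation is a multiple of `c x`, and transitivity makes `-1` occur.
  have hcx : c x = 1 ∨ c x = -1 := by
    obtain ⟨g, hg⟩ := htrans o (p o)
    obtain ⟨n, m, h⟩ := hV.exists_mem g
    have h1 := hlc g o
    rw [hg, hl, hcg g n m h] at h1
    exact Int.isUnit_iff.1 (IsUnit.of_mul_eq_one ((n : ℤ) - m) (by linarith))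
  have hcx0 : c x ≠ 0 := by rcases hcx with h | h <;> rw [h] <;> decide
  -- `V` does not fix the whole axis of `x`
  have haxis : ∀ v (M : ℕ), ¬ ∀ m : ℕ, M ≤ m → ∀ y ∈ V, ρ y (ρ (x ^ m) v) = ρ (x ^ m) v := by
    intro v M hM
    refine hp.not_transitive_zpow (x := x) hq hl hlc hcm hcx0 v fun w => ?_
    obtain ⟨g, rfl⟩ := htrans v w
    -- Writing `g = x⁻ⁿ y xᵐ` with `m ≥ M` and `y ∈ V` gives `gv = xᵐ⁻ⁿv`, so `⟨x⟩` alone would be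
    -- transitive.
    obtain ⟨n, m, -, hm, h⟩ := hV.exists_mem_of_le g M
    have h1 := hM m hm _ h
    refine ⟨-n + m, ?_⟩
    rw [hmul, hmul, hinv] at h1
    rw [zpow_add, hmul, zpow_natCast, ← h1, zpow_neg, zpow_natCast, hinv]
  -- Otherwise `x` moves some vertex `v` to its parent, and `V` fixes `xᵐv` for all large `m`,
  -- against `haxis`.
  have hcx1 : c x = 1 := by
    refine hcx.resolve_right fun hx => ?_
    obtain ⟨n, hn⟩ := hp.exists_iterate_eq hl (a := p o) (b := ρ x o) (by
      rw [hl, hlc, hx]; ring)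
    have hv : ρ x (p^[n] o) = p (p^[n] o) := by
      rw [← iterate_comm hcomm, ← hn, ← Function.iterate_succ_apply, Function.iterate_succ_apply']
    have hvm : ∀ m : ℕ, ρ (x ^ m) (p^[n] o) = p^[m] (p^[n] o) := fun m => by
      induction m with
      | zero => simp
      | succ m ih => rw [pow_succ, hmul, hv, ← hcomm, ih, Function.iterate_succ_apply']
    obtain ⟨M, hM⟩ := exists_forall_fixed hp hcont hcomm hc hl hlV (p^[n] o)
    refine haxis (p^[n] o) M fun m hm y hy => ?_
    rw [hvm]
    exact hM m hm y hy
  obtain ⟨v, hv⟩ : ∃ v, p (ρ x v) = v := by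
    obtain ⟨n, hn⟩ := hp.exists_iterate_eq hl (a := p (ρ x o)) (b := o) (by
      rw [hl, hlc, hcx1]; ring)
    refine ⟨p^[n] o, ?_⟩
    rw [← iterate_comm hcomm, ← Function.iterate_succ_apply' p, Function.iterate_succ_apply, hn]
  have hpow : ∀ (n : ℕ) v, p (ρ x v) = v → p^[n] (ρ (x ^ n) v) = v := by
    intro n v hv
    induction n with
    | zero => simp
    | succ n ih => rw [pow_succ, hmul, Function.iterate_succ_apply, hcomm, hv, ih]
  -- the last vertex of the axis that is fixed by `V`
  obtain ⟨w, hw, hwV, hwx⟩ : ∃ w, p (ρ x w) = w ∧ (∀ y ∈ V, ρ y w = w) ∧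
      ¬ ∀ y ∈ V, ρ y (ρ x w) = ρ x w := by
    by_contra! hall
    obtain ⟨M, hM⟩ := exists_forall_fixed hp hcont hcomm hc hl hlV v
    have h0 : p (ρ x (p^[M] v)) = p^[M] v := by
      rw [← iterate_comm hcomm, ← Function.iterate_succ_apply' p, Function.iterate_succ_apply, hv]
    have hfix : ∀ m : ℕ, p (ρ x (ρ (x ^ m) (p^[M] v))) = ρ (x ^ m) (p^[M] v) ∧
        ∀ y ∈ V, ρ y (ρ (x ^ m) (p^[M] v)) = ρ (x ^ m) (p^[M] v) := by
      intro m
      induction m with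
      | zero => simpa using ⟨h0, hM M le_rfl⟩
      | succ m ih =>
        rw [pow_succ', hmul]
        exact ⟨by rw [hcomm, ih.1], hall _ ih.1 ih.2⟩
    exact haxis (p^[M] v) 0 fun m _ => (hfix m).2
  -- The stabiliser `D` of `xw` in `V` contains `xVx⁻¹` because `V` fixes `w`, and `D ≠ V` by the
  -- choice of `w`; maximality leaves `D = xVx⁻¹`.
  have hstep : ∀ y ∈ V, ρ y (ρ x w) = ρ x w → y ∈ conj x V := by
    let D : Subgroup L := V ⊓
      { carrier := {y | ρ y (ρ x w) = ρ x w}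
        mul_mem' := fun {a b} ha hb => by
          simp only [Set.mem_ofPred_eq] at ha hb ⊢
          rw [hmul, hb, ha]
        one_mem' := by simp
        inv_mem' := fun {a} ha => by
          simp only [Set.mem_ofPred_eq] at ha ⊢
          nth_rw 1 [← ha]
          rw [hinv] }
    have hD1 : conj x V ≤ D := fun y hy => by
      refine ⟨hV.conj_le hy, ?_⟩
      have := hwV _ (mem_conj.1 hy)
      change ρ y (ρ x w) = ρ x w
      nth_rw 2 [← this]
      rw [← hmul, ← hmul]
      congr 2
      group
    intro y hy hyx
    rcases hmax D hD1 inf_le_left with h | h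
    · rw [← h]; exact ⟨hy, hyx⟩
    · refine (hwx fun z hz => ?_).elim
      rw [← h] at hz
      exact hz.2
  have hsteps : ∀ (n : ℕ), ∀ y ∈ V, ρ y (ρ (x ^ n) w) = ρ (x ^ n) w → y ∈ conj (x ^ n) V := by
    intro n
    induction n with
    | zero => intro y hy _; rwa [pow_zero, conj_one]
    | succ n ih =>
      intro y hy hyx
      -- An element fixing `xⁿ⁺¹w` fixes its ancestor `xw`, so it lies in `xVx⁻¹`; conjugating it by
      -- `x⁻¹` reduces to `xⁿw`.
      have h1 : p^[n] (ρ (x ^ (n + 1)) w) = ρ x w := by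
        rw [pow_succ, hmul, hpow n (ρ x w) (by rw [hcomm, hw])]
      have h2 := hstep y hy (by rw [← h1, ← iterate_comm hcomm, hyx])
      rw [mem_conj] at h2
      have h3 := ih _ h2 (by
        rw [hmul, hmul, ← hmul x, ← pow_succ', hyx, pow_succ', hmul, hinv])
      rw [pow_succ', conj_mul]
      exact mem_conj.2 h3
  have hstab : ∀ g, ρ g w = w ↔ g ∈ V := by
    refine fun g => ⟨fun hg => ?_, hwV g⟩
    obtain ⟨n, m, h⟩ := hV.exists_mem g
    have h1 := hlc g w
    rw [hg, hcg g n m h, hcx1] at h1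
    -- An element fixing `w` has translation zero, so it is `x⁻ⁿ v xⁿ` with `v ∈ V` fixing `xⁿw`;
    -- then `v ∈ xⁿVx⁻ⁿ`.
    obtain rfl : n = m := by omega
    have h2 := hsteps n _ h (by rw [hmul, hmul, hinv, hg])
    rw [mem_conj] at h2
    convert h2 using 1
    group
  have hcoset : ∀ g k, ρ g w = ρ k w ↔ (g : L ⧸ V) = k := fun g k => by
    rw [QuotientGroup.eq, ← hstab, hmul]
    refine ⟨fun h => by rw [← h, hinv], fun h => ?_⟩
    nth_rw 1 [← h]
    rw [← hmul]; simp
  let f : L ⧸ V → X := Quotient.lift (s := QuotientGroup.leftRel V) (fun g => ρ g w)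
    fun a b hab => (hcoset a b).2 (Quotient.sound hab)
  have hf : ∀ g : L, f (g : L ⧸ V) = ρ g w := fun _ => rfl
  have hfb : Function.Bijective f := by
    refine ⟨?_, fun u => ?_⟩
    · rintro ⟨a⟩ ⟨b⟩ hab
      exact (hcoset a b).1 hab
    · obtain ⟨g, rfl⟩ := htrans w u
      exact ⟨g, rfl⟩
  have hfp : ∀ a, p (f a) = f (hV.parent a) := fun a => by
    obtain ⟨g, rfl⟩ := QuotientGroup.mk_surjective a
    rw [hV.parent_mk, hf, hf, hmul, hcomm]
    congr 1
    rw [← hinv x (p w), ← hcomm, hw]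
  refine ⟨⟨Equiv.ofBijective f hfb, fun {a b} => ?_⟩, fun y a => ?_⟩
  · rw [hp.adj_iff, (hV.isParentMap hq).adj_iff]
    simp only [Equiv.ofBijective_apply, hfp, hfb.1.eq_iff]
  · obtain ⟨g, rfl⟩ := QuotientGroup.mk_surjective a
    exact hmul y g w

theorem IsContracting.exists_isCosetRep (hV : IsContracting V x q) (hq : 1 < q) (hT : T.IsTree)
    (hreg : T.IsRegularOfDegree (q + 1)) : ∃ ρ : L →* (T ≃g T), IsCosetRep V x ρ := by
  classical
  obtain ⟨o⟩ := hT.connected.nonempty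
  have hnb : ∀ u v, ∃ w, T.Adj v w ∧ w ≠ u := fun u v => by
    have : 1 < (T.neighborFinset v).card := by
      rw [SimpleGraph.card_neighborFinset_eq_degree, hreg v]; omega
    obtain ⟨w, hw, hne⟩ := Finset.exists_mem_ne this u
    exact ⟨w, (T.mem_neighborFinset v w).1 hw, hne⟩
  obtain ⟨o', ho, -⟩ := hnb o o
  obtain ⟨r⟩ := exists_ray hT (fun u v _ => hnb u v) ho
  obtain ⟨p, hp, -⟩ := r.exists_isParentMap hT hreg
  have : Nonempty X := ⟨o⟩
  obtain ⟨φ, -⟩ := (hV.isParentMap hq).exists_iso hp (by omega)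
  exact ScaleGroup.exists_isCosetRep φ

/-- The action on the coset tree is, up to conjugacy, the only scale-group representation if and
only if `xVx⁻¹` is maximal in `V`. -/
theorem IsContracting.forall_areConjugate_iff [TopologicalSpace L]
    [IsTopologicalGroup L] (hV : IsContracting V x q)
    (hq : 1 < q) (ho : IsOpen (V : Set L)) (hc : IsCompact (V : Set L)) (hT : T.IsTree)
    (hreg : T.IsRegularOfDegree (q + 1)) {ρ : L →* (T ≃g T)} (hρ : IsCosetRep V x ρ) :
    (∀ ρ' : L →* (T ≃g T), IsScaleRep ρ' → AreConjugate ρ ρ') ↔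
      ∀ D : Subgroup L, conj x V ≤ D → D ≤ V → D = conj x V ∨ D = V := by
  refine ⟨fun h D h1 h2 => ?_, fun h ρ' hρ' =>
    hρ.areConjugate (hV.isCosetRep_of_isScaleRep hq hc h hT hreg hρ')⟩
  have hD := hV.of_le h1 h2
  have hoD : IsOpen (D : Set L) := by
    refine Subgroup.isOpen_mono h1 ?_
    have : (conj x V : Set L) = (fun y => x⁻¹ * y * x) ⁻¹' V := Set.ext fun y => mem_conj
    rw [this]
    exact ho.preimage (by fun_prop)
  have hcD : IsCompact (D : Set L) := hc.of_isClosed_subset (D.isClosed_of_isOpen hoD) h2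
  obtain ⟨ρ', hρ'⟩ := hD.exists_isCosetRep hq hT hreg
  -- Conjugacy makes `D`, a vertex stabiliser of `ρ'`, a vertex stabiliser of `ρ`, hence a conjugate
  -- of `V`.
  obtain ⟨g, hg⟩ := h ρ' (hρ'.isScaleRep hD hq hoD hcD)
  obtain ⟨v, hv⟩ := hρ'.exists_stabilizer
  obtain ⟨k, hk⟩ := hρ.exists_conj_stabilizer (g⁻¹ v)
  have : D = conj k V := by
    ext y
    rw [← hv, ← hk, hg]
    change g (ρ y (g⁻¹ v)) = v ↔ _
    exact (g.toEquiv.eq_symm_apply).symm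
  subst this
  exact hV.eq_of_eq_conj hq h1 h2

end Primitive

end ScaleGroup

namespace ScaleGroup

/-! ### Primitivity as maximality of a point stabiliser. -/

section Maximal

variable {G : Type*} [Group G]

theorem isPreprimitive_quotient_iff {K V : Subgroup G} (hKV : K ≤ V) (hne : K ≠ V) :
    MulAction.IsPreprimitive V (V ⧸ K.subgroupOf V) ↔
      ∀ D : Subgroup G, K ≤ D → D ≤ V → D = K ∨ D = V := by
  have hnt : Nontrivial (V ⧸ K.subgroupOf V) := by
    obtain ⟨v, hv, hvK⟩ := SetLike.exists_of_lt (lt_of_le_of_ne hKV hne)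
    refine ⟨⟨((⟨v, hv⟩ : V) : V ⧸ K.subgroupOf V), ((1 : V) : V ⧸ K.subgroupOf V), fun h => ?_⟩⟩
    rw [eq_comm, QuotientGroup.eq] at h
    exact hvK (by simpa [Subgroup.mem_subgroupOf] using h)
  rw [← MulAction.isCoatom_stabilizer_iff_preprimitive V ((1 : V) : V ⧸ K.subgroupOf V),
    MulAction.stabilizer_quotient]
  constructor
  · rintro ⟨-, h⟩ D h1 h2
    rcases eq_or_lt_of_le (a := K.subgroupOf V) (b := D.subgroupOf V)
      (Subgroup.comap_mono h1) with heq | hlt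
    · left
      rw [Subgroup.subgroupOf_inj, inf_eq_left.2 hKV, inf_eq_left.2 h2] at heq
      exact heq.symm
    · right
      exact le_antisymm h2 (Subgroup.subgroupOf_eq_top.1 (h _ hlt))
  · intro h
    refine ⟨fun htop => hne (le_antisymm hKV (Subgroup.subgroupOf_eq_top.1 htop)), fun D hD => ?_⟩
    have hD' : D = (D.map V.subtype).subgroupOf V :=
      (Subgroup.comap_map_eq_self_of_injective V.subtype_injective D).symm
    rcases h (D.map V.subtype) (by
      rw [← inf_eq_left.2 hKV, ← Subgroup.subgroupOf_map_subtype]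
      exact Subgroup.map_mono hD.le) (Subgroup.map_subtype_le D) with heq | heq
    · rw [heq] at hD'
      exact (hD.ne hD'.symm).elim
    · rw [hD', heq, Subgroup.subgroupOf_self]

end Maximal

/-! ### Tidy subgroups: `U₋` is contracting, compact and open in `L`. -/

section Tidy

variable {G : Type*} [Group G] {x : G} {U : Subgroup G} {q : ℕ}

theorem conj_minusPart_le_minusMinus (x : G) (U : Subgroup G) (n : ℤ) :
    conj (x ^ n) (minusPart x U) ≤ minusMinus x U :=
  le_iSup (fun n : ℤ => conj (x ^ n) (minusPart x U)) n

theorem minusPart_le_minusMinus (x : G) (U : Subgroup G) : minusPart x U ≤ minusMinus x U := by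
  have := conj_minusPart_le_minusMinus x U 0
  rwa [zpow_zero, conj_one] at this

theorem mem_minusMinus_iff {y : G} :
    y ∈ minusMinus x U ↔ ∃ n : ℤ, y ∈ conj (x ^ n) (minusPart x U) := by
  rw [← SetLike.mem_coe, coe_minusMinus]; simp

theorem conj_mem_minusMinus {y : G} (hy : y ∈ minusMinus x U) (m : ℤ) :
    x ^ m * y * (x ^ m)⁻¹ ∈ minusMinus x U := by
  obtain ⟨n, hn⟩ := mem_minusMinus_iff.1 hy
  refine mem_minusMinus_iff.2 ⟨m + n, ?_⟩
  rw [mem_conj] at hn ⊢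
  convert hn using 1
  rw [zpow_add]; group

theorem minusPart_le (x : G) (U : Subgroup G) : minusPart x U ≤ U := fun y hy => by
  have := (Subgroup.mem_iInf.1 hy) 0
  rwa [pow_zero, conj_one] at this

/-- The elements `x⁻ⁿ v xᵐ` with `v` in `U₋` form the group `U₋₋ ⋊ ⟨x⟩`. -/
theorem exists_mem_of_mem_semidirect {g : G} (hg : g ∈ semidirect x U) :
    ∃ n m : ℕ, x ^ n * g * (x ^ m)⁻¹ ∈ minusPart x U := by
  have up : ∀ (k n m : ℕ) (g : G), x ^ n * g * (x ^ m)⁻¹ ∈ minusPart x U →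
      x ^ (k + n) * g * (x ^ (k + m))⁻¹ ∈ minusPart x U := fun k n m g h => by
    refine conj_pow_minusPart_le x U k (mem_conj.2 ?_)
    convert h using 1
    rw [pow_add, pow_add]; group
  let S : Subgroup G :=
    { carrier := {g | ∃ n m : ℕ, x ^ n * g * (x ^ m)⁻¹ ∈ minusPart x U}
      one_mem' := ⟨0, 0, by simp⟩
      mul_mem' := by
        rintro a b ⟨n, m, h⟩ ⟨n', m', h'⟩
        -- Conjugating by `xⁿ'` and `xᵐ` makes both inner exponents `m + n'`, so that they cancel in
        -- the product.
        refine ⟨n' + n, m + m', ?_⟩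
        have h1 := up n' n m a h
        have h2 := up m n' m' b h'
        rw [Nat.add_comm n' m] at h1
        convert mul_mem h1 h2 using 1
        group
      inv_mem' := by
        rintro a ⟨n, m, h⟩
        refine ⟨m, n, ?_⟩
        convert inv_mem h using 1
        group }
  have hS : semidirect x U ≤ S := by
    refine sup_le (iSup_le fun n y hy => ?_) ?_
    · rw [mem_conj] at hy
      obtain ⟨k, rfl | rfl⟩ := n.eq_nat_or_neg
      · refine ⟨0, 0, ?_⟩
        simpa using conj_pow_minusPart_le x U k (mem_conj.2 (by simpa using hy))
      · exact ⟨k, k, by simpa using hy⟩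
    · rw [Subgroup.zpowers_le]
      exact ⟨0, 1, by simp⟩
  exact hS hg

theorem relIndex_of_scaleAt (hscale : scaleAt x⁻¹ U = q) :
    (conj x (minusPart x U)).relIndex (minusPart x U) = q := by
  rw [← hscale, scaleAt, ← relIndex_conj x⁻¹, ← conj_mul, inv_mul_cancel, conj_one]
  rfl

theorem isContracting_baseSubgroup (hscale : scaleAt x⁻¹ U = q) :
    IsContracting (baseSubgroup x U) (generator x U) q := by
  have hle : minusPart x U ≤ semidirect x U := (minusPart_le_minusMinus x U).trans le_sup_left
  have hc : conj (generator x U) (baseSubgroup x U) =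
      (conj x (minusPart x U)).subgroupOf (semidirect x U) := by
    ext y
    rw [mem_conj, baseSubgroup, Subgroup.mem_subgroupOf, Subgroup.mem_subgroupOf, mem_conj]
    rfl
  refine ⟨?_, fun g => ?_, ?_⟩
  · rw [hc]
    exact Subgroup.comap_mono (conj_minusPart_le x U)
  · obtain ⟨n, m, h⟩ := exists_mem_of_mem_semidirect g.2
    exact ⟨n, m, Subgroup.mem_subgroupOf.2 h⟩
  · rw [hc, baseSubgroup, Subgroup.relIndex_subgroupOf hle, relIndex_of_scaleAt hscale]

theorem maximal_baseSubgroup_iff :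
    (∀ D : Subgroup (semidirect x U), conj (generator x U) (baseSubgroup x U) ≤ D →
      D ≤ baseSubgroup x U →
        D = conj (generator x U) (baseSubgroup x U) ∨ D = baseSubgroup x U) ↔
    ∀ D : Subgroup G, conj x (minusPart x U) ≤ D → D ≤ minusPart x U →
      D = conj x (minusPart x U) ∨ D = minusPart x U := by
  have hle : minusPart x U ≤ semidirect x U := (minusPart_le_minusMinus x U).trans le_sup_left
  have hle' := (conj_minusPart_le x U).trans hle
  have hc : conj (generator x U) (baseSubgroup x U) =
      (conj x (minusPart x U)).subgroupOf (semidirect x U) := by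
    ext y
    rw [mem_conj, baseSubgroup, Subgroup.mem_subgroupOf, Subgroup.mem_subgroupOf, mem_conj]
    rfl
  have hmap : ∀ K : Subgroup G, K ≤ semidirect x U →
      (K.subgroupOf (semidirect x U)).map (semidirect x U).subtype = K := fun K hK => by
    rw [Subgroup.subgroupOf_map_subtype, inf_eq_left.2 hK]
  have hcomap : ∀ D : Subgroup (semidirect x U),
      (D.map (semidirect x U).subtype).subgroupOf (semidirect x U) = D := fun D =>
    Subgroup.comap_map_eq_self_of_injective (semidirect x U).subtype_injective D
  rw [hc, baseSubgroup]
  constructor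
  · intro h D h1 h2
    rw [← hmap D (h2.trans hle)]
    refine (h (D.subgroupOf _) (Subgroup.comap_mono h1) (Subgroup.comap_mono h2)).imp
      (fun h => ?_) (fun h => ?_)
    · rw [h, hmap _ hle']
    · rw [h, hmap _ hle]
  · intro h D h1 h2
    rw [← hcomap D]
    refine (h (D.map (semidirect x U).subtype) ?_ ?_).imp (fun h => ?_) (fun h => ?_)
    · rw [← hmap _ hle']; exact Subgroup.map_mono h1
    · rw [← hmap _ hle]; exact Subgroup.map_mono h2
    · rw [h]
    · rw [h]

variable [TopologicalSpace G] [IsTopologicalGroup G]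

theorem isClosed_conj {K : Subgroup G} (hK : IsClosed (K : Set G)) (g : G) :
    IsClosed (conj g K : Set G) := by
  have : (conj g K : Set G) = (fun y => g⁻¹ * y * g) ⁻¹' K := Set.ext fun y => mem_conj
  rw [this]
  exact hK.preimage (by fun_prop)

theorem IsTidy.isClosed_minusPart (hU : IsTidy x U) : IsClosed (minusPart x U : Set G) := by
  rw [minusPart, plusPart, Subgroup.coe_iInf]
  exact isClosed_iInter fun n => isClosed_conj (U.isClosed_of_isOpen hU.isOpen) _

theorem IsTidy.isCompact_minusPart (hU : IsTidy x U) : IsCompact (minusPart x U : Set G) :=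
  hU.isCompact.of_isClosed_subset hU.isClosed_minusPart (minusPart_le x U)

/-- By Baire's theorem, `U₋` is open in `U₋₋`. -/
theorem IsTidy.exists_isOpen_inter_minusMinus [LocallyCompactSpace G] (hU : IsTidy x U) :
    ∃ O : Set G, IsOpen O ∧ O ∩ minusMinus x U = minusPart x U := by
  have hlc : LocallyCompactSpace (minusMinus x U) := hU.isClosed.locallyCompactSpace
  have hne : Nonempty (minusMinus x U) := ⟨1⟩
  -- Closedness of `U₋₋` makes it locally compact, so one of the countably many closed subgroups
  -- `xⁿU₋x⁻ⁿ` covering it has an interior point and is open. Conjugation by `x⁻ⁿ` carries this to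
  -- `U₋`.
  obtain ⟨n, y, hy⟩ := nonempty_interior_of_iUnion_of_closed (X := minusMinus x U)
    (f := fun n : ℤ =>
      (((conj (x ^ n) (minusPart x U)).subgroupOf (minusMinus x U) : Subgroup _) : Set _))
    (fun n => (isClosed_conj hU.isClosed_minusPart _).preimage continuous_subtype_val)
    (Set.eq_univ_of_forall fun y => by
      obtain ⟨n, hn⟩ := mem_minusMinus_iff.1 y.2
      exact Set.mem_iUnion.2 ⟨n, hn⟩)
  have hopen := Subgroup.isOpen_of_mem_nhds _ (mem_interior_iff_mem_nhds.1 hy)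
  obtain ⟨O, hO, hOn⟩ := isOpen_induced_iff.1 hopen
  have hmem : ∀ y ∈ minusMinus x U, y ∈ O ↔ y ∈ conj (x ^ n) (minusPart x U) := fun y hy =>
    Set.ext_iff.1 hOn ⟨y, hy⟩
  refine ⟨(fun y => x ^ n * y * (x ^ n)⁻¹) ⁻¹' O, hO.preimage (by fun_prop), Set.ext fun y => ?_⟩
  have hconj : x ^ n * y * (x ^ n)⁻¹ ∈ conj (x ^ n) (minusPart x U) ↔ y ∈ minusPart x U := by
    rw [mem_conj]
    simp [mul_assoc]
  constructor
  · rintro ⟨h1, h2⟩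
    exact hconj.1 ((hmem _ (conj_mem_minusMinus h2 n)).1 h1)
  · intro h
    have h2 := minusPart_le_minusMinus x U h
    exact ⟨(hmem _ (conj_mem_minusMinus h2 n)).2 (hconj.2 h), h2⟩

/-- The positive powers of a power of `x` are not contained in a compact set. -/
theorem IsTidy.not_forall_pow_mem [LocallyCompactSpace G] (hU : IsTidy x U) (hq : 1 < q)
    (hscale : scaleAt x⁻¹ U = q) {K : Set G} (hK : IsCompact K) (j : ℕ) :
    ¬ ∀ k : ℕ, x ^ ((j + 1) * k) ∈ K := by
  intro h
  obtain ⟨O, hO, hOH⟩ := hU.exists_isOpen_inter_minusMinus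
  have h1O : (1 : G) ∈ O :=
    (hOH.symm.subset (show (1 : G) ∈ (minusPart x U : Set G) from one_mem _)).1
  have hW : IsOpen {a : G × G | a.1⁻¹ * a.2 * a.1 ∈ O} := hO.preimage (by fun_prop)
  -- Compactness of `K` gives one neighbourhood `N` of `1` with `a⁻¹Na ⊆ O` for all `a ∈ K`. So `U₋
  -- ∩ N` lies in every `xⁱU₋x⁻ⁱ` with `i = (j + 1)k`, and their intersection `W` is open in the
  -- compact group `U₋`; its finite index would be at least every `qⁱ`.
  obtain ⟨u, N, -, hN, hKu, h1N, huN⟩ := generalized_tube_lemma hK (isCompact_singleton (x := (1 : G)))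
    hW (by rintro ⟨a, b⟩ ⟨-, hb⟩; obtain rfl : b = 1 := hb; simpa using h1O)
  have hsub : ∀ (k : ℕ), ∀ y ∈ minusPart x U, y ∈ N →
      y ∈ conj (x ^ ((j + 1) * k)) (minusPart x U) := fun k y hy hyN => by
    rw [mem_conj, ← SetLike.mem_coe, ← hOH]
    refine ⟨huN (Set.mk_mem_prod (hKu (h k)) hyN), ?_⟩
    have := conj_mem_minusMinus (minusPart_le_minusMinus x U hy) (-(((j + 1) * k : ℕ) : ℤ))
    rwa [zpow_neg, zpow_natCast, inv_inv] at this
  let W : Subgroup G := ⨅ k : ℕ, conj (x ^ ((j + 1) * k)) (minusPart x U)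
  have hWo : IsOpen ((W.subgroupOf (minusPart x U) : Subgroup _) : Set (minusPart x U)) := by
    refine Subgroup.isOpen_of_mem_nhds _ (g := 1) (Filter.mem_of_superset
      ((hN.preimage continuous_subtype_val).mem_nhds (h1N rfl)) fun y hy => ?_)
    exact Subgroup.mem_subgroupOf.2 (Subgroup.mem_iInf.2 fun k => hsub k y y.2 hy)
  have hcpt : CompactSpace (minusPart x U) := isCompact_iff_compactSpace.1 hU.isCompact_minusPart
  have hfin : Finite (minusPart x U ⧸ W.subgroupOf (minusPart x U)) :=
    Subgroup.quotient_finite_of_isOpen _ hWo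
  have hne : W.relIndex (minusPart x U) ≠ 0 :=
    (Subgroup.finiteIndex_of_finite_quotient (H := W.subgroupOf (minusPart x U))).index_ne_zero
  have hle : ∀ k : ℕ, q ^ ((j + 1) * k) ≤ W.relIndex (minusPart x U) := fun k => by
    rw [← relIndex_of_scaleAt hscale, ← relIndex_conj_pow (conj_minusPart_le x U)]
    exact Subgroup.relIndex_le_of_le_left (iInf_le _ k) hne
  have h1 := hle (W.relIndex (minusPart x U))
  have h2 := Nat.lt_pow_self hq (n := (j + 1) * W.relIndex (minusPart x U))
  have h3 : W.relIndex (minusPart x U) ≤ (j + 1) * W.relIndex (minusPart x U) :=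
    Nat.le_mul_of_pos_left _ (by omega)
  omega

/-- Write `y = x⁻ⁿ v xᵐ`. If `n = m` then `y ∈ U₋₋`. Otherwise the powers of `y` (or of `y⁻¹`) stay
in the compact group `U`, which traps the powers of some `xʲ⁺¹` in the compact set `U₋ · xⁿUx⁻ⁿ`
(with `m` in place of `n` for `y⁻¹`). -/
theorem IsTidy.mem_minusMinus_of_mem [LocallyCompactSpace G] (hU : IsTidy x U) (hq : 1 < q)
    (hscale : scaleAt x⁻¹ U = q) {y : G} (hy : y ∈ U) (hyL : y ∈ semidirect x U) :
    y ∈ minusMinus x U := by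
  have key : ∀ (y : G), y ∈ U → ∀ n j : ℕ,
      x ^ n * y * (x ^ (n + (j + 1)))⁻¹ ∉ minusPart x U := by
    intro y hy n j h
    set v := x ^ n * y * (x ^ (n + (j + 1)))⁻¹ with hv
    -- Since `xⁿyx⁻ⁿ = v xʲ⁺¹`, its `k`-th power can be collected with all powers of `x` on the
    -- right; the conjugates of `v` by positive powers of `x` remain in `U₋`.
    have hpow : ∀ k : ℕ, ∃ w ∈ minusPart x U, w * x ^ ((j + 1) * k) = x ^ n * y ^ k * (x ^ n)⁻¹ := by
      intro k
      induction k with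
      | zero => exact ⟨1, one_mem _, by simp⟩
      | succ k ih =>
        obtain ⟨w, hw, hwk⟩ := ih
        refine ⟨w * (x ^ ((j + 1) * k) * v * (x ^ ((j + 1) * k))⁻¹), mul_mem hw
          (conj_pow_minusPart_le x U ((j + 1) * k) (mem_conj.2 (by simpa [mul_assoc] using h))), ?_⟩
        have e1 : v * x ^ (j + 1) = x ^ n * y * (x ^ n)⁻¹ := by
          rw [hv, Nat.add_comm n, pow_add]; group
        have e2 : x ^ ((j + 1) * (k + 1)) = x ^ ((j + 1) * k) * x ^ (j + 1) := by
          rw [← pow_add, mul_add, mul_one]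
        calc _ = (w * x ^ ((j + 1) * k)) * (v * x ^ (j + 1)) := by rw [e2]; group
          _ = x ^ n * y ^ (k + 1) * (x ^ n)⁻¹ := by rw [hwk, e1, pow_succ y]; group
    have hK : IsCompact ((minusPart x U : Set G) * (fun u => x ^ n * u * (x ^ n)⁻¹) '' U) :=
      hU.isCompact_minusPart.mul (hU.isCompact.image (by fun_prop))
    refine hU.not_forall_pow_mem hq hscale hK j fun k => ?_
    obtain ⟨w, hw, hwk⟩ := hpow k
    exact ⟨w⁻¹, inv_mem hw, _, ⟨y ^ k, pow_mem hy k, hwk.symm⟩, by simp⟩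
  obtain ⟨n, m, h⟩ := exists_mem_of_mem_semidirect hyL
  rcases lt_trichotomy n m with hlt | rfl | hlt
  · obtain ⟨j, rfl⟩ := Nat.exists_eq_add_of_lt hlt
    exact (key y hy n j h).elim
  · refine mem_minusMinus_iff.2 ⟨-n, mem_conj.2 ?_⟩
    simpa using h
  · obtain ⟨j, rfl⟩ := Nat.exists_eq_add_of_lt hlt
    refine (key y⁻¹ (inv_mem hy) m j ?_).elim
    convert inv_mem h using 1
    rw [Nat.add_assoc]; group

/-- Intersecting with `U` is what passes from openness in `U₋₋` to openness in `L`, since `U ∩ L ⊆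
U₋₋`. -/
theorem IsTidy.isOpen_baseSubgroup [LocallyCompactSpace G] (hU : IsTidy x U) (hq : 1 < q)
    (hscale : scaleAt x⁻¹ U = q) : IsOpen (baseSubgroup x U : Set (semidirect x U)) := by
  obtain ⟨O, hO, hOH⟩ := hU.exists_isOpen_inter_minusMinus
  have : (baseSubgroup x U : Set (semidirect x U)) = Subtype.val ⁻¹' (O ∩ U) := by
    ext y
    change (y : G) ∈ (minusPart x U : Set G) ↔ (y : G) ∈ O ∧ (y : G) ∈ U
    constructor
    · intro h
      exact ⟨(hOH.symm.subset h).1, minusPart_le x U h⟩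
    · rintro ⟨h1, h2⟩
      exact hOH.subset ⟨h1, hU.mem_minusMinus_of_mem hq hscale h2 y.2⟩
  rw [this]
  exact (hO.inter hU.isOpen).preimage continuous_subtype_val

theorem IsTidy.isCompact_baseSubgroup (hU : IsTidy x U) :
    IsCompact (baseSubgroup x U : Set (semidirect x U)) := by
  have hle : minusPart x U ≤ semidirect x U := (minusPart_le_minusMinus x U).trans le_sup_left
  rw [Subtype.isCompact_iff]
  have : Subtype.val '' (baseSubgroup x U : Set (semidirect x U)) = (minusPart x U : Set G) := by
    ext y
    exact ⟨by rintro ⟨y, hy, rfl⟩; exact hy, fun hy => ⟨⟨y, hle hy⟩, hy, rfl⟩⟩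
  rw [this]
  exact hU.isCompact_minusPart

end Tidy

end ScaleGroup

theorem proposition4p6 {G : Type*} [Group G] [TopologicalSpace G] [IsTopologicalGroup G]
    [LocallyCompactSpace G] [TotallyDisconnectedSpace G]
    (x : G) (U : Subgroup G) (hU : ScaleGroup.IsTidy x U)
    (q : ℕ) (hq : 1 < q) (hscale : ScaleGroup.scaleAt x⁻¹ U = q)
    {X : Type*} (T : SimpleGraph X) [T.LocallyFinite] (hT : T.IsTree)
    (hreg : T.IsRegularOfDegree (q + 1)) :
    (∃ ρ : ScaleGroup.semidirect x U →* (T ≃g T), ScaleGroup.IsTreeRepresentation x U ρ) ∧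
    ∀ ρ : ScaleGroup.semidirect x U →* (T ≃g T), ScaleGroup.IsTreeRepresentation x U ρ →
      ScaleGroup.IsScaleRep ρ ∧
      ((∀ ρ' : ScaleGroup.semidirect x U →* (T ≃g T),
          ScaleGroup.IsScaleRep ρ' → ScaleGroup.AreConjugate ρ ρ') ↔
        MulAction.IsPreprimitive (ScaleGroup.minusPart x U)
          (ScaleGroup.minusPart x U ⧸
            (ScaleGroup.conj x (ScaleGroup.minusPart x U)).subgroupOf
              (ScaleGroup.minusPart x U))) := by
  have hV := ScaleGroup.isContracting_baseSubgroup hscale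
  have ho := hU.isOpen_baseSubgroup hq hscale
  have hc := hU.isCompact_baseSubgroup
  refine ⟨hV.exists_isCosetRep hq hT hreg, fun ρ hρ => ?_⟩
  have hρ' : ScaleGroup.IsCosetRep (ScaleGroup.baseSubgroup x U) (ScaleGroup.generator x U) ρ := hρ
  refine ⟨hρ'.isScaleRep hV hq ho hc, ?_⟩
  rw [hV.forall_areConjugate_iff hq ho hc hT hreg hρ', ScaleGroup.maximal_baseSubgroup_iff,
    ScaleGroup.isPreprimitive_quotient_iff (ScaleGroup.conj_minusPart_le x U)]
  -- The remaining condition `xVx⁻¹ ≠ V` holds because the index is `q > 1`.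
  intro h
  have := ScaleGroup.relIndex_of_scaleAt hscale
  rw [h, Subgroup.relIndex_self] at this
  omega
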